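/- Let $A\in\mathbb Z^{d\times n}$ be an integer matrix of full row rank $d$ with columns $a_1,\dots,a_n$, and let $b_1,\dots,b_n\in\mathbb R/\mathbb Z$. These data define the elliptic arrangement $\mathscr A_{\mathbb E}$ of the hypersurfaces $\{z\in\mathbb E^d : \sum_k a_{k,j}z_k=b_j+\omega b_j\}$ in the $d$-th power of an elliptic curve $\mathbb E=\mathbb C/\langle 1,\omega\rangle$, and the toric arrangement $\mathscr A$ of the hypersurfaces $H_j=\{z\in(\mathbb R/\mathbb Z)^d : \sum_k a_{k,j}z_k=b_j\}$. *Definitions.* A *polytope* is the convex hull of a finite nonempty set of points in a Euclidean space; its *faces* are its nonempty subsets $\{x\in P:\ell(x)=c\}$ with $\ell$ a linear form and $\ell\ge c$ on $P$. A *polyhedral CW complex* is a Hausdorff space $K$ with a family of polytopes $P_i$ and continuous maps $\alpha_i\colon P_i\to K$ $(i\in I)$ such that each $\alpha_i$ restricts to a homeomorphism of the relative interior of $P_i$ onto its image $F(i)$; $K$ is the disjoint union of the $F(i)$; a subset of $K$ is closed if and only if its intersection with each $\alpha_i(P_i)$ is closed; and for each $i$ and each face $S$ of $P_i$ there are $j\in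 I$ and a homeomorphism $\varphi\colon P_j\to S$ that carries faces to faces and satisfies $\alpha_j=\alpha_i\circ\varphi$. Its *face category* has object set $I$; the morphisms $j\to i$ are all such $\varphi$ from $P_j$ onto faces of $P_i$, composed as maps. It is *finite* if $I$ is finite. The hyperplanes $\{a_j^Tx=\beta\}$ with $1\le j\le n$ and $\beta\in\mathbb R$ of class $b_j$ cut $\mathbb R^d$ into faces, and the quotient of the resulting polyhedral complex by the translations by $\mathbb Z^d$ is a polyhedral CW structure $K_{\mathscr A}$ on the torus $(\mathbb R/\mathbb Z)^d$. Let $\mathscr F$ be its face category. For a cell $F$ of $K_{\mathscr A}$ put $\operatorname{supp}(F)=\{H\in\mathscr A: F\subseteq H\}$ and $\operatorname{codim}F=d-\dim F$, and let $Z_F\subseteq\mathbb R^d$ be the zonotope $\sum_{j:\,F\subseteq H_j}[-a_j,a_j]$. Let $\mathcal K$ be the full subcategory of $\mathscr F^{op}\times\mathscr F^{op}$ on the objects $(F,G)$ with $\operatorname{supp}(F)\cap\operatorname{supp}(G)=\emptyset$. *Claim.* The category $\mathcal K$ is isomorphic to the face category of a finite polyhedral CW complex $K(\mathscr A_{\mathbb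 E})$, in which the polytope of the cell corresponding to $(F,G)$ has dimension $\operatorname{codim}F+\operatorname{codim}G$. Moreover, for every object $(F,G)$ of $\mathcal K$ the slice category $\mathcal K/(F,G)$ is equivalent to the poset of nonempty faces of the product of zonotopes $Z_F\times Z_G$, and this product has dimension $\operatorname{codim}F+\operatorname{codim}G$. -/

import Mathlib

open CategoryTheory

namespace EllipticArr

noncomputable section

/-! ### Polytopes and their faces -/

section Polytopes

variable {E : Type*} [AddCommGroup E] [Module ℝ E]

/-- A (nonempty) convex polytope: the convex hull of a finite nonempty set of points. -/
def IsPolytope (P : Set E) : Prop :=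
  ∃ s : Set E, s.Finite ∧ s.Nonempty ∧ P = convexHull ℝ s

/-- `S` is a (nonempty) face of `P`: it is `{x ∈ P | ℓ x = c}` for a linear form `ℓ` and a
real `c` with `c ≤ ℓ x` on `P`. In particular `P` is a face of itself if it is nonempty. -/
def IsFace (P S : Set E) : Prop :=
  S.Nonempty ∧ ∃ (ℓ : E →ₗ[ℝ] ℝ) (c : ℝ), (∀ x ∈ P, c ≤ ℓ x) ∧ S = {x ∈ P | ℓ x = c}

/-- The poset of nonempty faces of `P`, ordered by inclusion. -/
abbrev FacePoset (P : Set E) : Type _ := {S : Set E // IsFace P S}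

/-- The dimension of a convex set: the dimension of its affine hull. -/
def polyDim (P : Set E) : ℕ := Module.finrank ℝ (vectorSpan ℝ P)

end Polytopes

/-! ### Polyhedral CW complexes and their face categories -/

/-- The data underlying a polyhedral CW complex on `X`: a family of subsets `P i` of Euclidean
spaces together with continuous (characteristic) maps `P i → X`. -/
structure CellFamily (X : Type) [TopologicalSpace X] where
  /-- the index set of the cells -/
  I : Type
  /-- the dimension of the Euclidean space in which `P i` lies -/
  N : I → ℕ
  /-- the polytope of the cell `i` -/
  P : (i : I) → Set (EuclideanSpace ℝ (Fin (N i)))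
  /-- the characteristic map of the cell `i` -/
  map : (i : I) → C(P i, X)

namespace CellFamily

variable {X : Type} [TopologicalSpace X] (K : CellFamily X)

/-- The open cell `F(i)`: the image of the (relative) interior of `P i`. -/
def openCell (i : K.I) : Set X := K.map i '' {x | x.1 ∈ intrinsicInterior ℝ (K.P i)}

/-- The face maps `P j → P i`: embeddings that carry faces of `P j` to faces of `P i` and are
compatible with the characteristic maps. The image of `P j` itself is then a face `S` of `P i`.
Since the faces of a face `S` of a polytope are exactly the faces of the polytope that are
contained in `S`, these are the polyhedral homeomorphisms `φ` of `P j` onto faces of `P i` with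
`map j = map i ∘ φ`. -/
@[ext]
structure FaceMap (j i : K.I) where
  /-- the underlying map -/
  toFun : K.P j → K.P i
  isEmbedding : Topology.IsEmbedding toFun
  isFace_image : ∀ S, IsFace (K.P j) S →
    IsFace (K.P i) ((fun x => (toFun x : EuclideanSpace ℝ (Fin (K.N i)))) '' {x | x.1 ∈ S})
  map_toFun : ∀ x, K.map i (toFun x) = K.map j x

/-- The subset of (the ambient space of) `P i` that is the image of a face map. -/
def FaceMap.range {K : CellFamily X} {j i : K.I} (φ : K.FaceMap j i) :
    Set (EuclideanSpace ℝ (Fin (K.N i))) :=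
  Set.range fun x => (φ.toFun x : EuclideanSpace ℝ (Fin (K.N i)))

/-- A polyhedral CW complex on `X`. -/
structure IsPolyhedralCW : Prop where
  t2 : T2Space X
  isPolytope : ∀ i, IsPolytope (K.P i)
  /-- the characteristic maps are homeomorphisms onto their image on the open polytopes -/
  isEmbedding_interior : ∀ i, Topology.IsEmbedding
    (fun x : {x : K.P i // x.1 ∈ intrinsicInterior ℝ (K.P i)} => K.map i x.1)
  /-- `X` is the disjoint union of the open cells -/
  pairwise_disjoint : Pairwise fun i j => Disjoint (K.openCell i) (K.openCell j)
  iUnion_openCell : ⋃ i, K.openCell i = Set.univ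
  /-- `X` has the weak topology with respect to the closed cells -/
  isClosed_iff : ∀ C : Set X, IsClosed C ↔ ∀ i, IsClosed (C ∩ Set.range (K.map i))
  /-- every face of `P i` is, compatibly with the characteristic maps, a polytope `P j` -/
  exists_faceMap : ∀ i S, IsFace (K.P i) S → ∃ (j : K.I) (φ : K.FaceMap j i), φ.range = S

/-- The identity face map. -/
def FaceMap.id {K : CellFamily X} (i : K.I) : K.FaceMap i i where
  toFun := fun x => x
  isEmbedding := Topology.IsEmbedding.id
  isFace_image := fun S hS => by
    have h : (fun x : K.P i => (x : EuclideanSpace ℝ (Fin (K.N i)))) '' {x | x.1 ∈ S} = S := by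
      obtain ⟨-, ℓ, c, -, rfl⟩ := hS
      ext y
      constructor
      · rintro ⟨x, hx, rfl⟩
        exact hx
      · intro hy
        exact ⟨⟨y, hy.1⟩, hy, rfl⟩
    rw [h]
    exact hS
  map_toFun := fun _ => rfl

/-- The composite of two face maps is the composite of the underlying maps. -/
def FaceMap.comp {K : CellFamily X} {j i k : K.I} (φ : K.FaceMap j i) (ψ : K.FaceMap i k) :
    K.FaceMap j k where
  toFun := fun x => ψ.toFun (φ.toFun x)
  isEmbedding := ψ.isEmbedding.comp φ.isEmbedding
  isFace_image := fun S hS => by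
    have h := ψ.isFace_image _ (φ.isFace_image S hS)
    convert h using 1
    ext y
    constructor
    · rintro ⟨x, hx, rfl⟩
      exact ⟨φ.toFun x, ⟨x, hx, rfl⟩, rfl⟩
    · rintro ⟨z, ⟨x, hx, hz⟩, rfl⟩
      have e : φ.toFun x = z := Subtype.ext hz
      exact ⟨x, hx, by simp only [e]⟩
  map_toFun := fun x => by rw [ψ.map_toFun, φ.map_toFun]

/-- The objects of the face category: the cells. -/
abbrev FaceCat (K : CellFamily X) : Type := K.I

/-- The face category: morphisms are the face maps. -/
instance : Category K.FaceCat where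
  Hom j i := K.FaceMap j i
  id i := FaceMap.id i
  comp φ ψ := φ.comp ψ

end CellFamily

/-! ### Toric arrangements -/

section Toric

variable {d n : ℕ} (A : Matrix (Fin d) (Fin n) ℤ) (b : Fin n → UnitAddCircle)

/-- The compact torus `(ℝ/ℤ)^d`, written additively. -/
abbrev Torus (d : ℕ) : Type := Fin d → UnitAddCircle

/-- The universal covering `ℝ^d → (ℝ/ℤ)^d`. -/
def torusProj (d : ℕ) : C(EuclideanSpace ℝ (Fin d), Torus d) where
  toFun x := fun k => ((x k : ℝ) : UnitAddCircle)
  continuous_toFun := by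
    refine continuous_pi fun k => ?_
    exact (AddCircle.continuous_mk' (1 : ℝ)).comp (by fun_prop)

/-- The hypersurface `H_j = {z | ∑ k, A k j • z k = b j}` of the torus. -/
def hypersurface (j : Fin n) : Set (Torus d) := {z | ∑ k, A k j • z k = b j}

/-- The toric arrangement: the set of the hypersurfaces `H_j`. -/
def toricArrangement : Set (Set (Torus d)) := Set.range (hypersurface A b)

/-- The linear form on `ℝ^d` given by the `j`-th column of `A`. -/
def columnForm (j : Fin n) (x : EuclideanSpace ℝ (Fin d)) : ℝ := ∑ k, (A k j : ℝ) * x k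

/-- `x` and `y` lie in the same (open) face of the lifted arrangement in `ℝ^d`, whose hyperplanes
are all `{columnForm A j = β}` where `β` is a real number with class `b j`: they lie on the same
side of, or both on, each of these hyperplanes. -/
def SameFace (x y : EuclideanSpace ℝ (Fin d)) : Prop :=
  ∀ (j : Fin n) (β : ℝ), (β : UnitAddCircle) = b j →
    SignType.sign (columnForm A j x - β) = SignType.sign (columnForm A j y - β)

/-- The open face of the lifted arrangement that contains `x`. -/
def liftedFace (x : EuclideanSpace ℝ (Fin d)) : Set (EuclideanSpace ℝ (Fin d)) :=
  {y | SameFace A b x y}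

/-- A vector of `ℤ^d`, as a vector of `ℝ^d`. -/
def latticeVec (v : Fin d → ℤ) : EuclideanSpace ℝ (Fin d) := WithLp.toLp 2 fun k => (v k : ℝ)

theorem columnForm_add (j : Fin n) (x y : EuclideanSpace ℝ (Fin d)) :
    columnForm A j (x + y) = columnForm A j x + columnForm A j y := by
  simp [columnForm, mul_add, Finset.sum_add_distrib]

theorem columnForm_latticeVec (j : Fin n) (v : Fin d → ℤ) :
    columnForm A j (latticeVec v) = ((∑ k, A k j * v k : ℤ) : ℝ) := by
  simp [columnForm, latticeVec]

theorem SameFace.add_latticeVec {x y : EuclideanSpace ℝ (Fin d)} (h : SameFace A b x y)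
    (v : Fin d → ℤ) : SameFace A b (x + latticeVec v) (y + latticeVec v) := by
  intro j β hβ
  have key := h j (β - ((∑ k, A k j * v k : ℤ) : ℝ)) (by
    rw [AddCircle.coe_sub, hβ]
    have : (((∑ k, A k j * v k : ℤ) : ℝ) : UnitAddCircle) = 0 := by
      rw [AddCircle.coe_eq_zero_iff]
      exact ⟨∑ k, A k j * v k, by simp⟩
    rw [this, sub_zero])
  rw [columnForm_add, columnForm_add, columnForm_latticeVec]
  convert key using 2 <;> ring

/-- Two points of `ℝ^d` are related if the faces of the lifted arrangement that contain them lie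
in the same orbit of `ℤ^d`. -/
def faceOrbitSetoid : Setoid (EuclideanSpace ℝ (Fin d)) where
  r x y := ∃ v : Fin d → ℤ, SameFace A b (x + latticeVec v) y
  iseqv :=
    { refl := fun x => ⟨0, fun j β _ => by
        have h : latticeVec (0 : Fin d → ℤ) = 0 := by ext k; simp [latticeVec]
        rw [h, add_zero]⟩
      symm := by
        rintro x y ⟨v, h⟩
        refine ⟨-v, ?_⟩
        have h' := h.add_latticeVec A b (-v)
        have e : x + latticeVec v + latticeVec (-v) = x := by ext k; simp [latticeVec]
        rw [e] at h'
        exact fun j β hβ => (h' j β hβ).symm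
      trans := by
        rintro x y z ⟨v, h⟩ ⟨w, h'⟩
        refine ⟨v + w, ?_⟩
        have h2 := h.add_latticeVec A b w
        have e : x + latticeVec (v + w) = x + latticeVec v + latticeVec w := by
          ext k; simp [latticeVec, add_assoc]
        rw [e]
        exact fun j β hβ => (h2 j β hβ).trans (h' j β hβ) }

/-- The cellularization of the torus induced by the toric arrangement, i.e. the quotient by `ℤ^d`
of the polyhedral complex of the lifted arrangement. Its cells are the `ℤ^d`-orbits of faces of
the lifted arrangement; the polytope of a cell is the closure of a chosen face in the orbit, and
the characteristic map is the restriction of the universal covering. -/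
def toricComplex : CellFamily (Torus d) where
  I := Quotient (faceOrbitSetoid A b)
  N _ := d
  P c := closure (liftedFace A b c.out)
  map _ := (torusProj d).restrict _

/-- The face category `ℱ` of the toric arrangement. -/
abbrev toricFaceCat : Type := (toricComplex A b).FaceCat

/-- The hypersurfaces of the toric arrangement that contain the cell `F`. -/
def supp (F : toricFaceCat A b) : Set (Set (Torus d)) :=
  {H ∈ toricArrangement A b | (toricComplex A b).openCell F ⊆ H}

/-- The codimension in the torus of the cell `F`. -/
def codim (F : toricFaceCat A b) : ℕ := d - polyDim ((toricComplex A b).P F)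

/-- The condition `supp F ∩ supp G = ∅` on pairs of cells. -/
def suppDisjoint : ObjectProperty ((toricFaceCat A b)ᵒᵖ × (toricFaceCat A b)ᵒᵖ) :=
  fun x => supp A b x.1.unop ∩ supp A b x.2.unop = ∅

/-- The category `𝒦`: objects are the pairs `(F, G)` with `supp F ∩ supp G = ∅`, morphisms are
pairs of morphisms of `ℱᵒᵖ`. -/
abbrev EllipticCat : Type := (suppDisjoint A b).FullSubcategory

/-- The first component `F` of an object `(F, G)` of `𝒦`. -/
def EllipticCat.fst {A : Matrix (Fin d) (Fin n) ℤ} {b : Fin n → UnitAddCircle}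
    (x : EllipticCat A b) : toricFaceCat A b := x.obj.1.unop

/-- The second component `G` of an object `(F, G)` of `𝒦`. -/
def EllipticCat.snd {A : Matrix (Fin d) (Fin n) ℤ} {b : Fin n → UnitAddCircle}
    (x : EllipticCat A b) : toricFaceCat A b := x.obj.2.unop

/-- The zonotope `∑_j [-a_j, a_j]` in `ℝ^d`, where `j` ranges over the indices with `F ⊆ H_j` and
`a_j` is the `j`-th column of `A`. -/
def zonotope (F : toricFaceCat A b) : Set (EuclideanSpace ℝ (Fin d)) :=
  {y | ∃ t : Fin n → ℝ, (∀ j, t j ∈ Set.Icc (-1 : ℝ) 1) ∧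
    (∀ j, hypersurface A b j ∉ supp A b F → t j = 0) ∧
    ∀ k, y k = ∑ j, t j * (A k j : ℝ)}

end Toric

end

end EllipticArr

namespace EllipticArr

/-! ### Convex sets, their relative interiors and faces -/

section Convex

variable {E : Type*} [NormedAddCommGroup E] [NormedSpace ℝ E]

/-! Near a point in the relative interior of a cell `F`, the lifted arrangement is the central
arrangement of the hyperplanes through that point, and its faces are the cones of the normal fan of
the zonotope `Z_F`. Faces of `Z_F` therefore correspond, with order reversed, to the lifted faces
whose closure contains the point, that is, to the morphisms out of `F` in the face category. The
face of a morphism `F ⟶ F'` consists of the maximizers of a linear form pointing from `F` into `F'`.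
It is a translate of `Z_{F'}`, by the signed sum of the columns through `F` on which the form does
not vanish.

These translations compose, so the zonotopes form a `FaceSystem` on the opposite face category: each
face of the polytope of `x` comes from exactly one morphism into `x` (`homShift_comp`,
`exists_hom_of_isFace_zonotope`, `sigma_eq_of_image_homShift_eq`). Full row rank enters here,
because a lattice vector must be recovered from its values on the columns. Face systems are stable
under products and under restriction to sieves. The pairs with disjoint supports form a sieve, since
supports shrink along morphisms out of a cell.

Every face system identifies slices with face posets (`overEquivalence`). A finite one also yields a
CW complex, by gluing its polytopes along the translations. Its face category is the index category
because a face map differs from the identity by a continuous function with finitely many values on a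
connected polytope (`exists_faceMap_eq`). The dimension formula holds because the span of the
columns through `F` is the orthogonal complement of the direction of `F` (`polyDim_zonotope`). -/

theorem IsFace.subset {P S : Set E} (h : IsFace P S) : S ⊆ P := by
  obtain ⟨-, ℓ, c, -, rfl⟩ := h
  exact fun x hx => hx.1

theorem IsFace.of_subset {P S T : Set E} (hS : IsFace P S) (hT : IsFace P T) (h : S ⊆ T) :
    IsFace T S := by
  obtain ⟨hn, ℓ, c, hc, rfl⟩ := hS
  refine ⟨hn, ℓ, c, fun x hx => hc x (hT.subset hx), ?_⟩
  ext x
  exact ⟨fun hx => ⟨h hx, hx.2⟩, fun hx => ⟨hT.subset hx.1, hx.2⟩⟩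

theorem IsFace.convex {P S : Set E} (hP : Convex ℝ P) (hS : IsFace P S) : Convex ℝ S := by
  obtain ⟨-, ℓ, c, -, rfl⟩ := hS
  exact hP.inter (convex_hyperplane ℓ.isLinear c)

theorem IsPolytope.convex {P : Set E} (h : IsPolytope P) : Convex ℝ P := by
  obtain ⟨s, -, -, rfl⟩ := h
  exact convex_convexHull ℝ s

theorem IsPolytope.isCompact {P : Set E} (h : IsPolytope P) : IsCompact P := by
  obtain ⟨s, hs, -, rfl⟩ := h
  exact hs.isCompact_convexHull ℝ

theorem IsPolytope.nonempty {P : Set E} (h : IsPolytope P) : P.Nonempty := by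
  obtain ⟨s, -, hs, rfl⟩ := h
  exact hs.convexHull

/-- A point of the relative interior can be moved a bit away from any other point. -/
theorem exists_add_smul_sub_mem {S : Set E} {p q : E} (hp : p ∈ intrinsicInterior ℝ S)
    (hq : q ∈ S) : ∃ ε : ℝ, 0 < ε ∧ p + ε • (p - q) ∈ S := by
  obtain ⟨y, hy, rfl⟩ := mem_intrinsicInterior.1 hp
  let q' : affineSpan ℝ S := ⟨q, subset_affineSpan ℝ S hq⟩
  let g : ℝ → affineSpan ℝ S := fun t => ⟨(y : E) + t • ((y : E) - q), by
    have := AffineMap.lineMap_mem (-t) y.2 q'.2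
    rw [AffineMap.lineMap_apply] at this
    convert this using 1
    simp only [q', vsub_eq_sub, vadd_eq_add, neg_smul]
    rw [add_comm, ← smul_neg, neg_sub]⟩
  have hg : Continuous g := by
    refine Continuous.subtype_mk ?_ _
    fun_prop
  have h0 : g 0 = y := Subtype.ext (by simp [g])
  have hmem : ∀ᶠ t in nhds (0 : ℝ), g t ∈ interior ((↑) ⁻¹' S : Set (affineSpan ℝ S)) :=
    hg.continuousAt.eventually_mem (by rw [h0]; exact isOpen_interior.mem_nhds hy)
  obtain ⟨ε, h1, h2⟩ := ((hmem.filter_mono nhdsWithin_le_nhds).and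
    (self_mem_nhdsWithin : Set.Ioi (0 : ℝ) ∈ nhdsWithin 0 (Set.Ioi 0))).exists
  exact ⟨ε, h2, interior_subset (s := ((↑) ⁻¹' S : Set (affineSpan ℝ S))) h1⟩

/-- If the form defining `T` exceeded its minimum at some `q ∈ S`, pushing `p` slightly away from
`q` inside `S` would take it below the minimum. -/
theorem subset_of_mem_intrinsicInterior {P S T : Set E} (hSP : S ⊆ P) (hT : IsFace P T) {p : E}
    (hp : p ∈ intrinsicInterior ℝ S) (hpT : p ∈ T) : S ⊆ T := by
  obtain ⟨-, ℓ, c, hc, rfl⟩ := hT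
  intro q hq
  refine ⟨hSP hq, le_antisymm ?_ (hc q (hSP hq))⟩
  obtain ⟨ε, hε, h⟩ := exists_add_smul_sub_mem hp hq
  have h1 := hc _ (hSP h)
  rw [map_add, map_smul, map_sub, hpT.2, smul_eq_mul] at h1
  nlinarith

/-- The relative interiors of distinct faces are disjoint. -/
theorem IsFace.eq_of_mem_intrinsicInterior {P S T : Set E} (hS : IsFace P S) (hT : IsFace P T)
    {p : E} (hpS : p ∈ intrinsicInterior ℝ S) (hpT : p ∈ intrinsicInterior ℝ T) : S = T :=
  (subset_of_mem_intrinsicInterior hS.subset hT hpS (intrinsicInterior_subset hpT)).antisymm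
    (subset_of_mem_intrinsicInterior hT.subset hS hpT (intrinsicInterior_subset hpS))

/-- A point of a convex set that is not in the relative interior lies in a proper face. -/
theorem exists_isFace_ne_of_notMem_intrinsicInterior [FiniteDimensional ℝ E] {P : Set E}
    (hP : Convex ℝ P) {p : E} (hpP : p ∈ P) (hp : p ∉ intrinsicInterior ℝ P) :
    ∃ S, IsFace P S ∧ p ∈ S ∧ S ≠ P := by
  -- Translating `p` to the origin of the direction space turns the relative interior into an
  -- ordinary interior, so that Hahn–Banach gives a supporting form there.
  let V := (affineSpan ℝ P).direction
  have hpA : p ∈ affineSpan ℝ P := subset_affineSpan ℝ P hpP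
  let C : Set V := {v | p + (v : E) ∈ P}
  have hC : Convex ℝ C := by
    intro v hv w hw a b ha hb hab
    have := hP hv hw ha hb hab
    simp only [C, Set.mem_ofPred_eq]
    convert this using 1
    simp only [Submodule.coe_add, Submodule.coe_smul, smul_add]
    rw [add_add_add_comm, ← add_smul, hab, one_smul]
  let f : affineSpan ℝ P → V := fun y => ⟨(y : E) - p, by
    simpa using AffineSubspace.vsub_mem_direction y.2 hpA⟩
  have hf : Continuous f := by
    refine Continuous.subtype_mk ?_ _
    fun_prop
  let g : V → affineSpan ℝ P := fun v => ⟨p + v, by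
    have := AffineSubspace.vadd_mem_of_mem_direction v.2 hpA
    rwa [vadd_eq_add, add_comm] at this⟩
  have hg : Continuous g := by
    refine Continuous.subtype_mk ?_ _
    fun_prop
  have h0 : (0 : V) ∉ interior C := by
    intro h
    refine hp (mem_intrinsicInterior.2 ⟨⟨p, hpA⟩, ?_, rfl⟩)
    refine interior_maximal (t := f ⁻¹' interior C) ?_ (isOpen_interior.preimage hf) ?_
    · intro y hy
      have := interior_subset (s := C) hy
      simpa [C, f] using this
    · have : f ⟨p, hpA⟩ = 0 := Subtype.ext (by simp [f])
      simpa [this] using h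
  obtain ⟨y0, hy0⟩ := Set.Nonempty.intrinsicInterior hP ⟨p, hpP⟩
  obtain ⟨y, hy, -⟩ := mem_intrinsicInterior.1 hy0
  have hne : (interior C).Nonempty := by
    refine ⟨f y, interior_maximal (t := g ⁻¹' interior ((↑) ⁻¹' P)) ?_
      (isOpen_interior.preimage hg) ?_⟩
    · intro v hv
      exact interior_subset (s := ((↑) ⁻¹' P : Set (affineSpan ℝ P))) hv
    · have : g (f y) = y := Subtype.ext (by simp [f, g])
      simpa [this] using hy
  obtain ⟨φ, hφ⟩ := geometric_hahn_banach_open_point hC.interior isOpen_interior h0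
  rw [map_zero] at hφ
  have hle : ∀ v ∈ C, φ v ≤ 0 := by
    intro v hv
    have h1 : v ∈ closure (interior C) := by
      rw [hC.closure_interior_eq_closure_of_nonempty_interior hne]
      exact subset_closure hv
    exact closure_minimal (fun w hw => (hφ w hw).le) (isClosed_le φ.continuous continuous_const) h1
  obtain ⟨ψ, hψ⟩ := φ.toLinearMap.exists_extend
  have hψ' : ∀ v : V, ψ v = φ v := fun v => by
    rw [← φ.coe_coe, ← hψ]; rfl
  have hval : ∀ x (hx : x ∈ affineSpan ℝ P), ψ x = ψ p + φ (f ⟨x, hx⟩) := by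
    intro x hx
    rw [← hψ']
    simp [f]
  refine ⟨{x ∈ P | (-ψ) x = -ψ p}, ⟨⟨p, hpP, rfl⟩, -ψ, -ψ p, ?_, rfl⟩, ⟨hpP, rfl⟩, ?_⟩
  · intro x hx
    have := hle (f ⟨x, subset_affineSpan ℝ P hx⟩) (by simpa [C, f] using hx)
    rw [LinearMap.neg_apply, hval x (subset_affineSpan ℝ P hx)]
    linarith
  · intro h
    -- The form is strictly negative at interior points of `C`, so the face is proper.
    obtain ⟨v, hv⟩ := hne
    have h1 : p + (v : E) ∈ P := interior_subset (s := C) hv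
    rw [← h] at h1
    have h2 := h1.2
    have h3 := hφ v hv
    rw [LinearMap.neg_apply, map_add, hψ' v] at h2
    linarith

theorem IsFace.vadd {P S : Set E} (h : IsFace P S) (v : E) :
    IsFace ((fun x => x + v) '' P) ((fun x => x + v) '' S) := by
  obtain ⟨hn, ℓ, c, hc, rfl⟩ := h
  refine ⟨hn.image _, ℓ, c + ℓ v, ?_, ?_⟩
  · rintro _ ⟨x, hx, rfl⟩
    simpa using hc x hx
  · ext y
    constructor
    · rintro ⟨x, hx, rfl⟩
      exact ⟨⟨x, hx.1, rfl⟩, by simp [hx.2]⟩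
    · rintro ⟨⟨x, hx, rfl⟩, h⟩
      exact ⟨x, ⟨hx, by simpa using h⟩, rfl⟩

theorem mem_intrinsicInterior_vadd {P : Set E} {p : E} (h : p ∈ intrinsicInterior ℝ P) (v : E) :
    p + v ∈ intrinsicInterior ℝ ((fun x => x + v) '' P) := by
  have := (AffineIsometryEquiv.vaddConst ℝ v).toAffineIsometry.intrinsicInterior_image P
  have e : ⇑(AffineIsometryEquiv.vaddConst ℝ v).toAffineIsometry = fun x => x + v := rfl
  rw [e] at this
  rw [this]
  exact ⟨p, h, rfl⟩

theorem IsFace.prod {F : Type*} [NormedAddCommGroup F] [NormedSpace ℝ F] {P S : Set E}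
    {Q T : Set F} (hS : IsFace P S) (hT : IsFace Q T) : IsFace (P ×ˢ Q) (S ×ˢ T) := by
  obtain ⟨hn, ℓ, c, hc, rfl⟩ := hS
  obtain ⟨hn', ℓ', c', hc', rfl⟩ := hT
  refine ⟨hn.prod hn', ℓ.coprod ℓ', c + c', ?_, ?_⟩
  · rintro ⟨x, y⟩ ⟨hx, hy⟩
    exact add_le_add (hc x hx) (hc' y hy)
  · ext ⟨x, y⟩
    simp only [Set.mem_prod, Set.mem_ofPred_eq, LinearMap.coprod_apply]
    constructor
    · rintro ⟨⟨hx, h⟩, hy, h'⟩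
      exact ⟨⟨hx, hy⟩, by rw [h, h']⟩
    · rintro ⟨⟨hx, hy⟩, h⟩
      have h1 := hc x hx
      have h2 := hc' y hy
      exact ⟨⟨hx, by linarith⟩, hy, by linarith⟩

/-- A linear form on a product is a sum of forms on the factors, and the sum is minimal exactly
where both summands are. -/
theorem IsFace.exists_eq_prod {F : Type*} [NormedAddCommGroup F] [NormedSpace ℝ F] {P : Set E}
    {Q : Set F} {R : Set (E × F)} (h : IsFace (P ×ˢ Q) R) :
    ∃ S T, IsFace P S ∧ IsFace Q T ∧ R = S ×ˢ T := by
  obtain ⟨⟨⟨x₀, y₀⟩, h₀⟩, ℓ, c, hc, rfl⟩ := h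
  have hℓ : ∀ x y, ℓ (x, y) = ℓ (x, 0) + ℓ (0, y) := fun x y => by simp [← map_add]
  obtain ⟨⟨hx₀, hy₀⟩, e₀⟩ := h₀
  simp only at hx₀ hy₀
  rw [hℓ] at e₀
  have h1 : ∀ x ∈ P, ℓ (x₀, 0) ≤ ℓ (x, 0) := fun x hx => by
    have := hc (x, y₀) ⟨hx, hy₀⟩
    rw [hℓ] at this
    linarith
  have h2 : ∀ y ∈ Q, ℓ (0, y₀) ≤ ℓ (0, y) := fun y hy => by
    have := hc (x₀, y) ⟨hx₀, hy⟩
    rw [hℓ] at this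
    linarith
  refine ⟨{x ∈ P | ℓ (x, 0) = ℓ (x₀, 0)}, {y ∈ Q | ℓ (0, y) = ℓ (0, y₀)},
    ⟨⟨x₀, hx₀, rfl⟩, ℓ.comp (LinearMap.inl ℝ E F), _, h1, rfl⟩,
    ⟨⟨y₀, hy₀, rfl⟩, ℓ.comp (LinearMap.inr ℝ E F), _, h2, rfl⟩, ?_⟩
  ext ⟨x, y⟩
  simp only [Set.mem_prod, Set.mem_ofPred_eq]
  rw [hℓ x y]
  constructor
  · rintro ⟨⟨hx, hy⟩, h⟩
    have := h1 x hx
    have := h2 y hy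
    exact ⟨⟨hx, by linarith⟩, hy, by linarith⟩
  · rintro ⟨⟨hx, h⟩, hy, h'⟩
    exact ⟨⟨hx, hy⟩, by linarith⟩

theorem IsFace.image_equiv {F : Type*} [NormedAddCommGroup F] [NormedSpace ℝ F] {P S : Set E}
    (L : E ≃ₗ[ℝ] F) (h : IsFace P S) : IsFace (L '' P) (L '' S) := by
  obtain ⟨hn, ℓ, c, hc, rfl⟩ := h
  refine ⟨hn.image _, ℓ.comp L.symm.toLinearMap, c, ?_, ?_⟩
  · rintro _ ⟨x, hx, rfl⟩
    simpa using hc x hx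
  · ext y
    constructor
    · rintro ⟨x, hx, rfl⟩
      exact ⟨⟨x, hx.1, rfl⟩, by simp [hx.2]⟩
    · rintro ⟨⟨x, hx, rfl⟩, h⟩
      exact ⟨x, ⟨hx, by simpa using h⟩, rfl⟩

theorem IsPolytope.image {F : Type*} [NormedAddCommGroup F] [NormedSpace ℝ F] {P : Set E}
    (L : E →ₗ[ℝ] F) (h : IsPolytope P) : IsPolytope (L '' P) := by
  obtain ⟨s, hs, hn, rfl⟩ := h
  exact ⟨L '' s, hs.image _, hn.image _, L.image_convexHull s⟩

theorem IsPolytope.prod {F : Type*} [NormedAddCommGroup F] [NormedSpace ℝ F] {P : Set E}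
    {Q : Set F} (hP : IsPolytope P) (hQ : IsPolytope Q) : IsPolytope (P ×ˢ Q) := by
  obtain ⟨s, hs, hn, rfl⟩ := hP
  obtain ⟨t, ht, hn', rfl⟩ := hQ
  exact ⟨s ×ˢ t, hs.prod ht, hn.prod hn', (convexHull_prod s t).symm⟩

/-- A bounded nonempty set is not contained in a proper translate of itself. -/
theorem eq_zero_of_image_add_subset {P : Set E} (hP : IsCompact P) (hn : P.Nonempty) {v : E}
    (h : (fun x => x + v) '' P ⊆ P) : v = 0 := by
  obtain ⟨x, hx⟩ := hn
  have hk : ∀ k : ℕ, x + (k : ℝ) • v ∈ P := by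
    intro k
    induction k with
    | zero => simpa using hx
    | succ k ih =>
      have := h ⟨_, ih, rfl⟩
      convert this using 1
      push_cast
      rw [add_smul, one_smul, add_assoc]
  obtain ⟨R, hR⟩ := hP.isBounded.exists_norm_le
  by_contra hv
  have hv' : 0 < ‖v‖ := norm_pos_iff.2 hv
  obtain ⟨k, hk'⟩ := exists_nat_gt ((R + ‖x‖) / ‖v‖)
  rw [div_lt_iff₀ hv'] at hk'
  have h1 := hR _ (hk k)
  have h2 : ‖(k : ℝ) • v‖ ≤ ‖x + (k : ℝ) • v‖ + ‖x‖ := by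
    have := norm_sub_le (x + (k : ℝ) • v) x
    rwa [add_sub_cancel_left] at this
  rw [norm_smul, Real.norm_natCast] at h2
  linarith

end Convex

/-! ### Systems of polytopes whose faces are indexed by morphisms -/

/-- A functor from `C` to polytopes and translations onto faces such that every face of the
polytope of `x` comes from exactly one morphism with target `x`. -/
structure FaceSystem (C : Type) [Category.{0} C] (V : Type*) [NormedAddCommGroup V]
    [NormedSpace ℝ V] where
  /-- the polytope of an object -/
  poly : C → Set V
  /-- the translation vector of a morphism -/
  shift : {y x : C} → (y ⟶ x) → V
  shift_id : ∀ x, shift (𝟙 x) = 0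
  shift_comp : ∀ {z y x : C} (g : z ⟶ y) (f : y ⟶ x), shift (g ≫ f) = shift g + shift f
  isPolytope : ∀ x, IsPolytope (poly x)
  isFace : ∀ {y x : C} (f : y ⟶ x), IsFace (poly x) ((fun p => p + shift f) '' poly y)
  exists_hom : ∀ {x : C} {T : Set V}, IsFace (poly x) T →
    ∃ (y : C) (f : y ⟶ x), T = (fun p => p + shift f) '' poly y
  hom_unique : ∀ {y z x : C} (f : y ⟶ x) (g : z ⟶ x),
    (fun p => p + shift f) '' poly y = (fun p => p + shift g) '' poly z →
      (⟨y, f⟩ : Σ y, (y ⟶ x)) = ⟨z, g⟩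

namespace FaceSystem

variable {C : Type} [Category.{0} C] {V : Type*} [NormedAddCommGroup V] [NormedSpace ℝ V]
  (S : FaceSystem C V)

/-- The face given by a morphism. -/
def face {y x : C} (f : y ⟶ x) : Set V := (fun p => p + S.shift f) '' S.poly y

theorem isFace_face {y x : C} (f : y ⟶ x) : IsFace (S.poly x) (S.face f) := S.isFace f

theorem face_id (x : C) : S.face (𝟙 x) = S.poly x := by
  simp [face, S.shift_id]

theorem face_comp {z y x : C} (g : z ⟶ y) (f : y ⟶ x) :
    S.face (g ≫ f) = (fun p => p + S.shift f) '' S.face g := by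
  simp only [face, Set.image_image, S.shift_comp, add_assoc]

theorem add_shift_mem {y x : C} (f : y ⟶ x) {p : V} (hp : p ∈ S.poly y) :
    p + S.shift f ∈ S.poly x :=
  (S.isFace f).subset ⟨p, hp, rfl⟩

theorem eq_of_shift_eq {y x : C} {f g : y ⟶ x} (h : S.shift f = S.shift g) : f = g := by
  have := S.hom_unique f g (by rw [h])
  simpa using this

theorem face_le {z y x : C} (g : z ⟶ y) (f : y ⟶ x) : S.face (g ≫ f) ⊆ S.face f := by
  rw [face_comp]
  exact Set.image_mono (S.isFace g).subset

/-- Compactness of the polytope excludes nonzero shifts. This is what makes characteristic maps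
injective on relative interiors. -/
theorem shift_endo {x : C} (f : x ⟶ x) : S.shift f = 0 :=
  eq_zero_of_image_add_subset (S.isPolytope x).isCompact (S.isPolytope x).nonempty
    (S.isFace f).subset

/-- Nested faces come from a factorization of the corresponding morphisms. -/
theorem exists_comp_eq {z y x : C} (g : z ⟶ x) (f : y ⟶ x) (h : S.face g ⊆ S.face f) :
    ∃ k : z ⟶ y, k ≫ f = g := by
  -- Moved back by the shift of `f`, the smaller face becomes a face of the polytope of `y`, hence
  -- comes from a morphism `k`.
  have h1 := ((S.isFace_face g).of_subset (S.isFace_face f) h).vadd (-S.shift f)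
  have e : (fun p => p + -S.shift f) '' S.face f = S.poly y := by
    simp only [face, Set.image_image, add_neg_cancel_right, Set.image_id']
  rw [e] at h1
  obtain ⟨w, k, hk⟩ := S.exists_hom h1
  have h2 : S.face (k ≫ f) = S.face g := by
    rw [face_comp, face, ← hk]
    simp only [Set.image_image, neg_add_cancel_right, Set.image_id']
  have h3 := S.hom_unique (k ≫ f) g h2
  obtain ⟨rfl, h4⟩ := Sigma.mk.inj h3
  exact ⟨k, eq_of_heq h4⟩

/-- The functor that sends a morphism `y ⟶ x` to the corresponding face of the polytope of `x`. -/
def overFunctor (x : C) : Over x ⥤ FacePoset (S.poly x) where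
  obj f := ⟨S.face f.hom, S.isFace_face f.hom⟩
  map {f g} k := homOfLE (by
    have := S.face_le k.left g.hom
    rwa [Over.w k] at this)

instance (x : C) : (S.overFunctor x).Faithful where
  map_injective {f g k l} _ := by
    apply Over.OverMorphism.ext
    apply S.eq_of_shift_eq
    have h1 := congrArg S.shift (Over.w k)
    have h2 := congrArg S.shift (Over.w l)
    rw [S.shift_comp] at h1 h2
    exact add_right_cancel (h1.trans h2.symm)

instance (x : C) : (S.overFunctor x).Full where
  map_surjective {f g} h := by
    obtain ⟨k, hk⟩ := S.exists_comp_eq f.hom g.hom (leOfHom h)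
    exact ⟨Over.homMk k hk, Subsingleton.elim _ _⟩

instance (x : C) : (S.overFunctor x).EssSurj where
  mem_essImage T := by
    obtain ⟨y, f, hf⟩ := S.exists_hom T.2
    exact ⟨Over.mk f, ⟨eqToIso (Subtype.ext hf.symm)⟩⟩

/-- The slice category over `x` is equivalent to the face poset of the polytope of `x`. -/
noncomputable def overEquivalence (x : C) : Over x ≌ FacePoset (S.poly x) :=
  haveI : (S.overFunctor x).IsEquivalence := {}
  (S.overFunctor x).asEquivalence

/-- The product of two face systems. -/
def prod {D : Type} [Category.{0} D] {W : Type*} [NormedAddCommGroup W] [NormedSpace ℝ W]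
    (T : FaceSystem D W) : FaceSystem (C × D) (V × W) where
  poly x := S.poly x.1 ×ˢ T.poly x.2
  shift f := (S.shift f.1, T.shift f.2)
  shift_id x := Prod.ext (S.shift_id x.1) (T.shift_id x.2)
  shift_comp g f := Prod.ext (S.shift_comp g.1 f.1) (T.shift_comp g.2 f.2)
  isPolytope x := (S.isPolytope x.1).prod (T.isPolytope x.2)
  isFace f := by
    have := (S.isFace f.1).prod (T.isFace f.2)
    rwa [Set.prod_image_image_eq] at this
  exists_hom := by
    rintro ⟨x, y⟩ R hR
    obtain ⟨S', T', hS, hT, rfl⟩ := hR.exists_eq_prod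
    obtain ⟨x', f, rfl⟩ := S.exists_hom hS
    obtain ⟨y', g, rfl⟩ := T.exists_hom hT
    refine ⟨(x', y'), (f, g), ?_⟩
    rw [Set.prod_image_image_eq]
    rfl
  hom_unique := by
    rintro ⟨y, y'⟩ ⟨z, z'⟩ ⟨x, x'⟩ ⟨f, f'⟩ ⟨g, g'⟩ h
    have h1 : ((fun p => p + S.shift f) '' S.poly y) ×ˢ ((fun p => p + T.shift f') '' T.poly y') =
        ((fun p => p + S.shift g) '' S.poly z) ×ˢ ((fun p => p + T.shift g') '' T.poly z') := by
      rw [Set.prod_image_image_eq, Set.prod_image_image_eq]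
      exact h
    rw [Set.prod_eq_prod_iff_of_nonempty
      (((S.isPolytope y).nonempty.image _).prod ((T.isPolytope y').nonempty.image _))] at h1
    obtain ⟨rfl, h3⟩ := Sigma.mk.inj (S.hom_unique f g h1.1)
    obtain ⟨rfl, h4⟩ := Sigma.mk.inj (T.hom_unique f' g' h1.2)
    obtain rfl := eq_of_heq h3
    obtain rfl := eq_of_heq h4
    rfl

/-- The restriction of a face system to a sieve of objects. -/
def restrict (p : ObjectProperty C) (hp : ∀ {y x : C} (_ : y ⟶ x), p x → p y) :
    FaceSystem p.FullSubcategory V where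
  poly x := S.poly x.obj
  shift f := S.shift f.hom
  shift_id x := S.shift_id x.obj
  shift_comp g f := S.shift_comp g.hom f.hom
  isPolytope x := S.isPolytope x.obj
  isFace f := S.isFace f.hom
  exists_hom {x T} hT := by
    obtain ⟨y, f, h⟩ := S.exists_hom hT
    exact ⟨⟨y, hp f x.property⟩, ObjectProperty.homMk f, h⟩
  hom_unique := by
    rintro ⟨y, hy⟩ ⟨z, hz⟩ x ⟨f⟩ ⟨g⟩ h
    obtain ⟨h2, h3⟩ := Sigma.mk.inj (S.hom_unique f g h)
    dsimp only at h2
    subst h2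
    obtain rfl := eq_of_heq h3
    rfl

/-- The image of a face system under a linear isomorphism. -/
def map {W : Type*} [NormedAddCommGroup W] [NormedSpace ℝ W] (L : V ≃ₗ[ℝ] W) :
    FaceSystem C W where
  poly x := L '' S.poly x
  shift f := L (S.shift f)
  shift_id x := by rw [S.shift_id, map_zero]
  shift_comp g f := by rw [S.shift_comp, map_add]
  isPolytope x := (S.isPolytope x).image L.toLinearMap
  isFace f := by
    have := (S.isFace f).image_equiv L
    simpa only [Set.image_image, map_add] using this
  exists_hom {x T} hT := by
    have h := hT.image_equiv L.symm
    rw [Set.image_image] at h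
    simp only [LinearEquiv.symm_apply_apply, Set.image_id'] at h
    obtain ⟨y, f, h⟩ := S.exists_hom h
    refine ⟨y, f, ?_⟩
    have h' := congrArg (L '' ·) h
    simpa only [Set.image_image, map_add, LinearEquiv.apply_symm_apply, Set.image_id'] using h'
  hom_unique {y z x} f g h := by
    refine S.hom_unique f g ?_
    have h' := congrArg (L.symm '' ·) h
    simpa only [Set.image_image, map_add, LinearEquiv.symm_apply_apply] using h'

/-- Faces whose relative interiors meet coincide, and a face determines its morphism. All later
uniqueness statements about glued points rest on this. -/
theorem sigma_eq_of_add_shift_eq {x y z : C} (f : y ⟶ x) (g : z ⟶ x) {p q : V}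
    (hp : p ∈ intrinsicInterior ℝ (S.poly y)) (hq : q ∈ intrinsicInterior ℝ (S.poly z))
    (h : p + S.shift f = q + S.shift g) : (⟨y, f⟩ : Σ y, (y ⟶ x)) = ⟨z, g⟩ := by
  refine S.hom_unique f g ((S.isFace f).eq_of_mem_intrinsicInterior (S.isFace g)
    (mem_intrinsicInterior_vadd hp _) ?_)
  rw [h]
  exact mem_intrinsicInterior_vadd hq _

section Cells

variable [FiniteDimensional ℝ V] [Finite C] [∀ x y : C, Finite (x ⟶ y)]

/-- Every point of a polytope lies in the relative interior of a face. -/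
theorem exists_mem_intrinsicInterior {x : C} {p : V} (hp : p ∈ S.poly x) :
    ∃ (y : C) (f : y ⟶ x), ∃ q ∈ intrinsicInterior ℝ (S.poly y), p = q + S.shift f := by
  let M : Set (Σ y, (y ⟶ x)) := {f | p ∈ S.face f.2}
  -- A minimal face containing `p` works: were `p` outside its relative interior, a proper face of
  -- it would contain `p`.
  obtain ⟨⟨y, f⟩, hf, hmin⟩ := (Set.toFinite M).exists_minimalFor (fun f => S.face f.2) M
    ⟨⟨x, 𝟙 x⟩, by simpa [M, face_id] using hp⟩
  obtain ⟨q, hq, rfl⟩ := hf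
  refine ⟨y, f, q, ?_, rfl⟩
  by_contra hq'
  obtain ⟨T, hT, hqT, hne⟩ :=
    exists_isFace_ne_of_notMem_intrinsicInterior (S.isPolytope y).convex hq hq'
  obtain ⟨z, g, hg⟩ := S.exists_hom hT
  have h1 : (⟨z, g ≫ f⟩ : Σ y, (y ⟶ x)) ∈ M := by
    change _ ∈ S.face (g ≫ f)
    rw [face_comp, face, ← hg]
    exact ⟨q, hqT, rfl⟩
  have h2 : S.face f ⊆ S.face (g ≫ f) := hmin h1 (S.face_le g f)
  refine hne (hT.subset.antisymm ?_)
  rw [face_comp, face, show S.face g = T from hg.symm] at h2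
  exact (Set.image_subset_image_iff (add_left_injective _)).1 h2

end Cells

end FaceSystem

/-! ### The polyhedral CW complex of a face system -/

/-- Projection along a compact space is closed, so saturations of closed sets are closed. Normality
separates two classes by open sets, and the classes lying entirely inside each of these form
disjoint open sets of the quotient. -/
theorem t2Space_quotient_of_isClosed {Y : Type*} [TopologicalSpace Y] [CompactSpace Y] [T2Space Y]
    (s : Setoid Y) (hs : IsClosed {p : Y × Y | s p.1 p.2}) : T2Space (Quotient s) := by
  have hcl : IsClosedMap (Quotient.mk s) := by
    intro C hC
    refine isQuotientMap_quotient_mk'.isClosed_preimage.1 ?_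
    change IsClosed (Quotient.mk s ⁻¹' (Quotient.mk s '' C))
    have e : Quotient.mk s ⁻¹' (Quotient.mk s '' C) =
        Prod.snd '' ({p : Y × Y | s p.1 p.2} ∩ Prod.fst ⁻¹' C) := by
      ext y
      constructor
      · rintro ⟨x, hx, h⟩
        exact ⟨(x, y), ⟨Quotient.exact h, hx⟩, rfl⟩
      · rintro ⟨⟨x, y⟩, ⟨h, hx⟩, rfl⟩
        exact ⟨x, hx, Quotient.sound h⟩
    rw [e]
    exact isClosedMap_snd_of_compactSpace _ (hs.inter (hC.preimage continuous_fst))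
  have hfib : ∀ a : Y, IsClosed {y | s a y} := fun a =>
    hs.preimage (Continuous.prodMk_right a)
  refine ⟨fun x y hxy => ?_⟩
  induction x using Quotient.inductionOn with | _ a =>
  induction y using Quotient.inductionOn with | _ c =>
  have hd : Disjoint {y | s a y} {y | s c y} := by
    rw [Set.disjoint_left]
    exact fun y h1 h2 => hxy (Quotient.sound (s.trans h1 (s.symm h2)))
  obtain ⟨U, W, hU, hW, haU, hcW, hUW⟩ := normal_separation (hfib a) (hfib c) hd
  refine ⟨(Quotient.mk s '' Uᶜ)ᶜ, (Quotient.mk s '' Wᶜ)ᶜ, (hcl _ hU.isClosed_compl).isOpen_compl,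
    (hcl _ hW.isClosed_compl).isOpen_compl, ?_, ?_, ?_⟩
  · rintro ⟨y, hy, h⟩
    exact hy (haU (s.symm (Quotient.exact h)))
  · rintro ⟨y, hy, h⟩
    exact hy (hcW (s.symm (Quotient.exact h)))
  · rw [Set.disjoint_left]
    intro z
    induction z using Quotient.inductionOn with | _ y =>
    intro h1 h2
    refine (fun hU hW => Set.disjoint_left.1 hUW hU hW : y ∈ U → y ∉ W) ?_ ?_
    · by_contra hy
      exact h1 ⟨y, hy, rfl⟩
    · by_contra hy
      exact h2 ⟨y, hy, rfl⟩

namespace FaceSystem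

section Gluing

variable {C : Type} [Category.{0} C] {V : Type} [NormedAddCommGroup V] [NormedSpace ℝ V]
  (S : FaceSystem C V)

/-- The translation of a polytope onto a face. -/
def translate {y x : C} (f : y ⟶ x) (p : S.poly y) : S.poly x :=
  ⟨p + S.shift f, S.add_shift_mem f p.2⟩

theorem isEmbedding_translate {y x : C} (f : y ⟶ x) : Topology.IsEmbedding (S.translate f) := by
  have h : Topology.IsEmbedding fun p : S.poly y => p.1 + S.shift f :=
    (Homeomorph.addRight (S.shift f)).isEmbedding.comp Topology.IsEmbedding.subtypeVal
  exact Topology.IsEmbedding.of_comp (Continuous.subtype_mk h.continuous _)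
    continuous_subtype_val h

theorem isFace_image_translate {y x : C} (f : y ⟶ x) {T : Set (V)}
    (hT : IsFace (S.poly y) T) :
    IsFace (S.poly x) ((fun p => (S.translate f p : V)) ''
      {p | p.1 ∈ T}) := by
  obtain ⟨z, g, rfl⟩ := S.exists_hom hT
  have h := S.isFace_face (g ≫ f)
  rw [S.face_comp] at h
  refine Eq.subst (motive := IsFace (S.poly x)) ?_ h
  symm
  ext q
  constructor
  · rintro ⟨p, hp, rfl⟩
    exact ⟨p, hp, rfl⟩
  · rintro ⟨p, hp, rfl⟩
    exact ⟨⟨p, (S.isFace g).subset hp⟩, hp, rfl⟩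

theorem range_translate {y x : C} (f : y ⟶ x) :
    (Set.range fun p => (S.translate f p : V)) = S.face f := by
  ext q
  constructor
  · rintro ⟨p, rfl⟩
    exact ⟨p, p.2, rfl⟩
  · rintro ⟨p, hp, rfl⟩
    exact ⟨⟨p, hp⟩, rfl⟩

theorem translate_id (x : C) : S.translate (𝟙 x) = id :=
  funext fun p => Subtype.ext (by simp [translate, S.shift_id])

theorem translate_comp {z y x : C} (g : z ⟶ y) (f : y ⟶ x) :
    S.translate (g ≫ f) = fun p => S.translate f (S.translate g p) :=
  funext fun p => Subtype.ext (by simp only [translate, S.shift_comp, add_assoc])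

theorem eq_of_translate_eq {y x : C} {f g : y ⟶ x} (h : S.translate f = S.translate g) :
    f = g := by
  obtain ⟨p, hp⟩ := (S.isPolytope y).nonempty
  exact S.eq_of_shift_eq (add_left_cancel (congrArg Subtype.val (congrFun h ⟨p, hp⟩)))

/-- The disjoint union of the polytopes. -/
abbrev Total : Type := Σ x : C, S.poly x

/-- Two points of polytopes are glued if they are images of the same point. -/
def Glued (a c : S.Total) : Prop :=
  ∃ (z : C) (p : S.poly z) (f : z ⟶ a.1) (g : z ⟶ c.1),
    (a.2 : V) = p + S.shift f ∧ (c.2 : V) = p + S.shift g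

variable [FiniteDimensional ℝ V] [Finite C] [∀ x y : C, Finite (x ⟶ y)]

/-- Represent the common preimage by a relative interior point of some polytope. By uniqueness of
the morphism reaching an interior point of `a`, that polytope is the one of `a` and the morphism is
the identity. -/
theorem exists_hom_of_glued {a c : S.Total} (h : S.Glued a c)
    (ha : (a.2 : V) ∈ intrinsicInterior ℝ (S.poly a.1)) :
    ∃ f : a.1 ⟶ c.1, (c.2 : V) = a.2 + S.shift f := by
  obtain ⟨x, p⟩ := a
  obtain ⟨z, q, f, g, h1, h2⟩ := h
  obtain ⟨w, k, r, hr, hq⟩ := S.exists_mem_intrinsicInterior q.2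
  dsimp only at h1 h2 f g ha ⊢
  rw [hq, add_assoc, ← S.shift_comp] at h1 h2
  have h3 := S.sigma_eq_of_add_shift_eq (𝟙 x) (k ≫ f) ha hr (by rw [S.shift_id, add_zero, h1])
  obtain ⟨rfl, h4⟩ := Sigma.mk.inj h3
  rw [← eq_of_heq h4, S.shift_id, add_zero] at h1
  exact ⟨k ≫ g, by rw [h1, h2]⟩

/-- The gluing relation is an equivalence relation. -/
def gluing : Setoid S.Total where
  r := S.Glued
  iseqv :=
    { refl := fun a => ⟨a.1, a.2, 𝟙 _, 𝟙 _, by simp [S.shift_id], by simp [S.shift_id]⟩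
      symm := by
        rintro a c ⟨z, p, f, g, h1, h2⟩
        exact ⟨z, p, g, f, h2, h1⟩
      trans := by
        rintro a c e ⟨z, p, f, g, h1, h2⟩ ⟨w, q, f', g', h1', h2'⟩
        -- With both witnesses replaced by relative interior points, their equal images in the
        -- polytope of the middle point force the witnesses to agree.
        obtain ⟨z', k, r, hr, hp⟩ := S.exists_mem_intrinsicInterior p.2
        obtain ⟨w', k', r', hr', hq⟩ := S.exists_mem_intrinsicInterior q.2
        rw [hp, add_assoc, ← S.shift_comp] at h1 h2
        rw [hq, add_assoc, ← S.shift_comp] at h1' h2'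
        obtain ⟨rfl, h4⟩ := Sigma.mk.inj
          (S.sigma_eq_of_add_shift_eq (k ≫ g) (k' ≫ f') hr hr' (h2.symm.trans h1'))
        rw [h2, eq_of_heq h4, add_right_cancel_iff] at h1'
        subst h1'
        exact ⟨z', ⟨r, intrinsicInterior_subset hr⟩, k ≫ f, k' ≫ g', h1, h2'⟩ }

/-- The space obtained by gluing the polytopes along their faces. -/
abbrev Space : Type := Quotient S.gluing

instance (x : C) : CompactSpace (S.poly x) :=
  isCompact_iff_compactSpace.1 (S.isPolytope x).isCompact

/-- The relation is the continuous image of a finite disjoint union of polytopes, one for each pair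
of morphisms with a common source, and so is compact. -/
theorem isClosed_gluing : IsClosed {p : S.Total × S.Total | S.gluing p.1 p.2} := by
  let F : (Σ t : Σ z : C × C × C, (z.1 ⟶ z.2.1) × (z.1 ⟶ z.2.2), S.poly t.1.1) →
      S.Total × S.Total := fun u =>
    (⟨u.1.1.2.1, ⟨u.2 + S.shift u.1.2.1, S.add_shift_mem _ u.2.2⟩⟩,
      ⟨u.1.1.2.2, ⟨u.2 + S.shift u.1.2.2, S.add_shift_mem _ u.2.2⟩⟩)
  have hF : Continuous F := by
    have h : ∀ {z x : C} (f : z ⟶ x), Continuous fun p : S.poly z =>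
        (⟨x, S.translate f p⟩ : S.Total) := fun {z x} f =>
      (continuous_sigmaMk (σ := fun x => S.poly x)).comp (S.isEmbedding_translate f).continuous
    exact continuous_sigma fun t => (h t.2.1).prodMk (h t.2.2)
  have e : {p : S.Total × S.Total | S.gluing p.1 p.2} = Set.range F := by
    ext ⟨⟨x, p⟩, ⟨y, q⟩⟩
    constructor
    · rintro ⟨z, r, f, g, h1, h2⟩
      refine ⟨⟨⟨(z, x, y), (f, g)⟩, r⟩, ?_⟩
      refine Prod.ext ?_ ?_
      · exact congrArg (Sigma.mk x) (Subtype.ext h1.symm)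
      · exact congrArg (Sigma.mk y) (Subtype.ext h2.symm)
    · rintro ⟨⟨⟨⟨z, x', y'⟩, f, g⟩, r⟩, h⟩
      rw [← h]
      exact ⟨z, r, f, g, rfl, rfl⟩
  rw [e]
  exact (isCompact_range hF).isClosed

instance : T2Space S.Space := t2Space_quotient_of_isClosed _ S.isClosed_gluing

end Gluing

/-! ### The CW structure on the glued space and its face category -/

section Realization

variable {C : Type} [Category.{0} C] {N : ℕ} (S : FaceSystem C (EuclideanSpace ℝ (Fin N)))
  [Finite C] [∀ x y : C, Finite (x ⟶ y)]

/-- The characteristic map of the polytope of an object. -/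
noncomputable def charMap (x : C) : C(S.poly x, S.Space) :=
  ⟨fun p => Quotient.mk _ ⟨x, p⟩, continuous_quotient_mk'.comp continuous_sigmaMk⟩

/-- The polyhedral CW complex of a face system. -/
noncomputable def complex : CellFamily S.Space where
  I := C
  N _ := N
  P x := S.poly x
  map x := S.charMap x

theorem charMap_eq_iff {x y : C} {p : S.poly x} {q : S.poly y} :
    S.charMap x p = S.charMap y q ↔ S.Glued ⟨x, p⟩ ⟨y, q⟩ := Quotient.eq

theorem charMap_translate {y x : C} (f : y ⟶ x) (p : S.poly y) :
    S.charMap x (S.translate f p) = S.charMap y p :=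
  S.charMap_eq_iff.2 ⟨y, p, f, 𝟙 y, rfl, by simp [S.shift_id]⟩

/-- The face map of a morphism. -/
noncomputable def faceMap {y x : C} (f : y ⟶ x) : S.complex.FaceMap y x where
  toFun := S.translate f
  isEmbedding := S.isEmbedding_translate f
  isFace_image _ hT := S.isFace_image_translate f hT
  map_toFun p := S.charMap_translate f p

/-- A relative interior point is glued to another point of the same polytope only through an
endomorphism, whose shift is zero. Hence the relative interior is saturated, and the closed map `φ`
restricts to an embedding on it. -/
theorem isEmbedding_map_interior (x : C) : Topology.IsEmbedding
    (fun p : {p : S.poly x // p.1 ∈ intrinsicInterior ℝ (S.poly x)} => S.charMap x p.1) := by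
  let φ : S.poly x → S.Space := S.charMap x
  let D : Set (S.poly x) := {p | p.1 ∈ intrinsicInterior ℝ (S.poly x)}
  have hφ : Continuous φ := (S.charMap x).continuous
  have key : ∀ p q : S.poly x, p ∈ D → φ p = φ q → p = q := by
    intro p q hp h
    obtain ⟨f, hf⟩ := S.exists_hom_of_glued (S.charMap_eq_iff.1 h) hp
    rw [S.shift_endo, add_zero] at hf
    exact Subtype.ext hf.symm
  have hD : D = φ ⁻¹' (φ '' D) := by
    refine (Set.subset_preimage_image φ D).antisymm ?_
    rintro q ⟨p, hp, h⟩
    rwa [← key p q hp h]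
  have h1 : Topology.IsEmbedding ((φ '' D).restrictPreimage φ) := by
    refine (Topology.IsClosedEmbedding.of_continuous_injective_isClosedMap
      hφ.restrictPreimage ?_ (hφ.isClosedMap.restrictPreimage _)).isEmbedding
    rintro ⟨p, hp⟩ ⟨q, hq⟩ h
    rw [← hD] at hp
    exact Subtype.ext (key p q hp (congrArg Subtype.val h))
  exact (Topology.IsEmbedding.subtypeVal.comp h1).comp (Homeomorph.setCongr hD).isEmbedding

theorem disjoint_image_charMap {x y : C} (hxy : x ≠ y) :
    Disjoint (S.charMap x '' {p | p.1 ∈ intrinsicInterior ℝ (S.poly x)})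
      (S.charMap y '' {p | p.1 ∈ intrinsicInterior ℝ (S.poly y)}) := by
  rw [Set.disjoint_left]
  rintro _ ⟨p, hp, rfl⟩ ⟨q, hq, h⟩
  obtain ⟨f, hf⟩ := S.exists_hom_of_glued (S.charMap_eq_iff.1 h) hq
  have h2 := S.sigma_eq_of_add_shift_eq f (𝟙 x) hq hp (by rw [S.shift_id, add_zero]; exact hf.symm)
  exact hxy (congrArg Sigma.fst h2).symm

theorem iUnion_image_charMap :
    ⋃ x, S.charMap x '' {p | p.1 ∈ intrinsicInterior ℝ (S.poly x)} = Set.univ := by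
  refine Set.eq_univ_of_forall fun a => ?_
  induction a using Quotient.inductionOn with | _ a =>
  obtain ⟨x, p⟩ := a
  obtain ⟨y, f, q, hq, hp⟩ := S.exists_mem_intrinsicInterior p.2
  refine Set.mem_iUnion.2 ⟨y, ⟨q, intrinsicInterior_subset hq⟩, hq, ?_⟩
  rw [← S.charMap_translate f]
  exact congrArg (S.charMap x) (Subtype.ext hp.symm)

theorem isClosed_iff_inter_range_charMap (A : Set S.Space) :
    IsClosed A ↔ ∀ x, IsClosed (A ∩ Set.range (S.charMap x)) := by
  refine ⟨fun h x => h.inter (isCompact_range (S.charMap x).continuous).isClosed, fun h => ?_⟩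
  have e : A = ⋃ x, A ∩ Set.range (S.charMap x) := by
    rw [← Set.inter_iUnion]
    refine (Set.inter_eq_left.2 fun a _ => ?_).symm
    induction a using Quotient.inductionOn with | _ a =>
    exact Set.mem_iUnion.2 ⟨a.1, a.2, rfl⟩
  rw [e]
  exact isClosed_iUnion_of_finite h

theorem isPolyhedralCW_complex : S.complex.IsPolyhedralCW where
  t2 := inferInstance
  isPolytope := S.isPolytope
  isEmbedding_interior := S.isEmbedding_map_interior
  pairwise_disjoint _ _ h := S.disjoint_image_charMap h
  iUnion_openCell := S.iUnion_image_charMap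
  isClosed_iff := S.isClosed_iff_inter_range_charMap
  exists_faceMap x T hT := by
    obtain ⟨y, f, h⟩ := S.exists_hom hT
    exact ⟨y, S.faceMap f, (S.range_translate f).trans h.symm⟩

/-- Gluing forces `φ p - p` into the finite set of differences of shifts, so it is constant on the
connected polytope. At a relative interior point its value is the shift of a morphism. -/
theorem exists_faceMap_eq {y x : C} (φ : S.complex.FaceMap y x) : ∃ f, S.faceMap f = φ := by
  let D : Set (EuclideanSpace ℝ (Fin N)) :=
    Set.range fun t : Σ z : C, (z ⟶ x) × (z ⟶ y) => S.shift t.2.1 - S.shift t.2.2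
  have hDfin : D.Finite := Set.finite_range _
  let φ' : S.poly y → S.poly x := φ.toFun
  have hφ : ∀ p, S.Glued ⟨x, φ' p⟩ ⟨y, p⟩ := fun p => S.charMap_eq_iff.1 (φ.map_toFun p)
  let δ : S.poly y → EuclideanSpace ℝ (Fin N) := fun p => (φ' p : EuclideanSpace ℝ (Fin N)) - p
  have hδ : Continuous δ :=
    (continuous_subtype_val.comp φ.isEmbedding.continuous).sub continuous_subtype_val
  have hδD : Set.MapsTo δ Set.univ D := by
    intro p _
    obtain ⟨z, q, f, g, h1, h2⟩ := hφ p
    refine ⟨⟨z, f, g⟩, ?_⟩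
    simp only at h1 h2
    simp only [δ, h1, h2]
    abel
  have : PreconnectedSpace (S.poly y) :=
    Subtype.preconnectedSpace (S.isPolytope y).convex.isPreconnected
  obtain ⟨p₀, hp₀⟩ := Set.Nonempty.intrinsicInterior (S.isPolytope y).convex
    (S.isPolytope y).nonempty
  obtain ⟨f, hf⟩ := S.exists_hom_of_glued (Setoid.symm' S.gluing
    (hφ ⟨p₀, intrinsicInterior_subset hp₀⟩)) hp₀
  refine ⟨f, ?_⟩
  have key : ∀ p, S.translate f p = φ' p := by
    intro p
    have h := isPreconnected_univ.constant_of_mapsTo hDfin.isDiscrete hδ.continuousOn hδD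
      (Set.mem_univ p) (Set.mem_univ ⟨p₀, intrinsicInterior_subset hp₀⟩)
    simp only [δ] at h hf
    rw [hf, add_sub_cancel_left, sub_eq_iff_eq_add, add_comm] at h
    exact Subtype.ext h.symm
  exact CellFamily.FaceMap.ext (funext key)

/-- The functor from the index category of a face system to the face category of its complex. -/
noncomputable def toFaceCat : C ⥤ S.complex.FaceCat where
  obj x := x
  map f := S.faceMap f
  map_id x := CellFamily.FaceMap.ext (S.translate_id x)
  map_comp g f := CellFamily.FaceMap.ext (S.translate_comp g f)

instance : S.toFaceCat.Faithful where
  map_injective h := S.eq_of_translate_eq (congrArg CellFamily.FaceMap.toFun h)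

instance : S.toFaceCat.Full where
  map_surjective φ := S.exists_faceMap_eq φ

instance : S.toFaceCat.EssSurj where
  mem_essImage x := ⟨x, ⟨Iso.refl _⟩⟩

theorem isEquivalence_toFaceCat : S.toFaceCat.IsEquivalence := {}

theorem bijective_toFaceCat_obj : Function.Bijective S.toFaceCat.obj := Function.bijective_id

end Realization

end FaceSystem

/-! ### Cells of the real line with vertices at the integers -/

/-- `t` lies in the closure of the cell of `s` for the decomposition of the real line into the
integers and the open intervals between them. -/
def Incident (s t : ℝ) : Prop := (⌊s⌋ : ℝ) ≤ t ∧ t ≤ ⌈s⌉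

theorem Incident.refl (s : ℝ) : Incident s s := ⟨Int.floor_le s, Int.le_ceil s⟩

theorem Incident.floor_le {s t : ℝ} (h : Incident s t) : ⌊s⌋ ≤ ⌊t⌋ := Int.le_floor.2 h.1

theorem Incident.le_ceil {s t : ℝ} (h : Incident s t) : ⌈t⌉ ≤ ⌈s⌉ := Int.ceil_le.2 h.2

theorem Incident.trans {s t r : ℝ} (h : Incident s t) (h' : Incident t r) : Incident s r :=
  ⟨le_trans (Int.cast_le.2 h.floor_le) h'.1, h'.2.trans (Int.cast_le.2 h.le_ceil)⟩

theorem Incident.add_intCast {s t : ℝ} (h : Incident s t) (m : ℤ) :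
    Incident (s + m) (t + m) := by
  rw [Incident, Int.floor_add_intCast, Int.ceil_add_intCast]
  push_cast
  exact ⟨by linarith [h.1], by linarith [h.2]⟩

theorem Incident.eq_of_intCast {m : ℤ} {t : ℝ} (h : Incident m t) : t = m := by
  rw [Incident, Int.floor_intCast, Int.ceil_intCast] at h
  exact le_antisymm h.2 h.1

/-- A non-integer lies in the closure of no cell but its own open interval. -/
theorem Incident.floor_eq_ceil_eq {s t : ℝ} (h : Incident s t) (ht : ∀ m : ℤ, t ≠ m) :
    ⌊s⌋ = ⌊t⌋ ∧ ⌈s⌉ = ⌈t⌉ := by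
  have h1 := h.floor_le
  have h2 := h.le_ceil
  have h3 : ⌊t⌋ < ⌈t⌉ := by
    have a := lt_of_le_of_ne (Int.floor_le t) (ht ⌊t⌋).symm
    exact Int.lt_ceil.2 a
  have h4 := Int.ceil_le_floor_add_one s
  omega

theorem Incident.eq_floor_or_eq_ceil {s : ℝ} {m : ℤ} (h : Incident s m) :
    m = ⌊s⌋ ∨ m = ⌈s⌉ := by
  have h1 := h.floor_le
  have h2 := h.le_ceil
  rw [Int.floor_intCast] at h1
  rw [Int.ceil_intCast] at h2
  have h4 := Int.ceil_le_floor_add_one s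
  omega

theorem incident_of_floor_eq_ceil_eq {s t : ℝ} (h : ⌊s⌋ = ⌊t⌋ ∧ ⌈s⌉ = ⌈t⌉) : Incident s t := by
  rw [Incident, h.1, h.2]
  exact Incident.refl t

theorem eventually_incident (r : ℝ) : ∀ᶠ s in nhds r, Incident s r := by
  have h1 : ∀ᶠ s in nhds r, s < (⌊r⌋ : ℝ) + 1 := gt_mem_nhds (Int.lt_floor_add_one r)
  have h2 : ∀ᶠ s in nhds r, (⌈r⌉ : ℝ) - 1 < s := lt_mem_nhds (by linarith [Int.ceil_lt_add_one r])
  filter_upwards [h1, h2] with s h1 h2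
  constructor
  · have : ⌊s⌋ < ⌊r⌋ + 1 := Int.floor_lt.2 (by push_cast; exact h1)
    exact Int.le_floor.1 (by omega)
  · have : ⌈r⌉ - 1 < ⌈s⌉ := Int.lt_ceil.2 (by push_cast; exact h2)
    exact Int.ceil_le.1 (by omega)

/-- Any positive weight on `s` moves a point of the closed cell into the open one. -/
theorem Incident.segment {s t θ : ℝ} (h : Incident s t) (h0 : 0 < θ) (h1 : θ ≤ 1) :
    ⌊s⌋ = ⌊t + θ * (s - t)⌋ ∧ ⌈s⌉ = ⌈t + θ * (s - t)⌉ := by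
  obtain ⟨ha, hb⟩ := h
  have e : t + θ * (s - t) = (1 - θ) * t + θ * s := by ring
  rw [e]
  have f1 := Int.floor_le s
  have f2 := Int.le_ceil s
  by_cases hs : ∃ m : ℤ, s = m
  · obtain ⟨m, rfl⟩ := hs
    rw [Int.floor_intCast] at ha
    rw [Int.ceil_intCast] at hb
    have : t = m := le_antisymm hb ha
    rw [this]
    rw [← add_mul, sub_add_cancel, one_mul]
    exact ⟨rfl, rfl⟩
  · push Not at hs
    have g1 := lt_of_le_of_ne f1 (hs ⌊s⌋).symm
    have g2 := lt_of_le_of_ne f2 (hs ⌈s⌉)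
    have hc : (⌈s⌉ : ℝ) ≤ ⌊s⌋ + 1 := by exact_mod_cast Int.ceil_le_floor_add_one s
    have k1 : (⌊s⌋ : ℝ) < (1 - θ) * t + θ * s := by nlinarith
    have k2 : (1 - θ) * t + θ * s < ⌈s⌉ := by nlinarith
    constructor
    · symm
      rw [Int.floor_eq_iff]
      exact ⟨k1.le, by linarith⟩
    · symm
      rw [Int.ceil_eq_iff]
      exact ⟨by linarith, k2.le⟩

theorem sign_sub_eq_iff {s t : ℝ} :
    (∀ m : ℤ, SignType.sign (s - m) = SignType.sign (t - m)) ↔ ⌊s⌋ = ⌊t⌋ ∧ ⌈s⌉ = ⌈t⌉ := by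
  constructor
  · intro h
    have h1 : ∀ m : ℤ, (m : ℝ) ≤ s ↔ (m : ℝ) ≤ t := fun m => by
      rw [← sub_nonneg, ← sign_nonneg_iff, h, sign_nonneg_iff, sub_nonneg]
    have h2 : ∀ m : ℤ, s ≤ m ↔ t ≤ m := fun m => by
      rw [← sub_nonpos, ← sign_nonpos_iff, h, sign_nonpos_iff, sub_nonpos]
    constructor
    · exact le_antisymm (Int.le_floor.2 ((h1 _).1 (Int.floor_le s)))
        (Int.le_floor.2 ((h1 _).2 (Int.floor_le t)))
    · exact le_antisymm (Int.ceil_le.2 ((h2 _).2 (Int.le_ceil t)))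
        (Int.ceil_le.2 ((h2 _).1 (Int.le_ceil s)))
  · rintro ⟨h1, h2⟩ m
    rcases lt_trichotomy s m with h | h | h
    · have : t < m := by rwa [← Int.floor_lt, ← h1, Int.floor_lt]
      rw [sign_neg (sub_neg.2 h), sign_neg (sub_neg.2 this)]
    · subst h
      rw [Int.floor_intCast] at h1
      rw [Int.ceil_intCast] at h2
      have : t = m := le_antisymm (by rw [h2]; exact Int.le_ceil t)
        (by rw [h1]; exact Int.floor_le t)
      rw [this]
    · have : (m : ℝ) < t := by rwa [← Int.lt_ceil, ← h2, Int.lt_ceil]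
      rw [sign_pos (sub_pos.2 h), sign_pos (sub_pos.2 this)]

/-- Only `{m}` and the two open unit intervals next to it have `m` in their closure, and the sign of
`s - m` tells these three apart. -/
theorem floor_ceil_eq_of_sign_eq {s t : ℝ} {m : ℤ} (hs : Incident s m) (ht : Incident t m)
    (h : SignType.sign (s - m) = SignType.sign (t - m)) : ⌊s⌋ = ⌊t⌋ ∧ ⌈s⌉ = ⌈t⌉ := by
  have aux : ∀ {r : ℝ}, Incident r m → (m : ℝ) < r → ⌊r⌋ = m ∧ ⌈r⌉ = m + 1 := by
    intro r hr hlt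
    have h1 : ⌊r⌋ ≤ m := by exact_mod_cast hr.1
    have h2 : m ≤ ⌊r⌋ := Int.le_floor.2 hlt.le
    have h3 : m < ⌈r⌉ := Int.lt_ceil.2 hlt
    have h4 := Int.ceil_le_floor_add_one r
    omega
  have aux' : ∀ {r : ℝ}, Incident r m → r < (m : ℝ) → ⌊r⌋ = m - 1 ∧ ⌈r⌉ = m := by
    intro r hr hlt
    have h1 : m ≤ ⌈r⌉ := by exact_mod_cast hr.2
    have h2 : ⌈r⌉ ≤ m := Int.ceil_le.2 hlt.le
    have h3 : ⌊r⌋ < m := Int.floor_lt.2 hlt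
    have h4 := Int.ceil_le_floor_add_one r
    omega
  rcases lt_trichotomy s m with h1 | h1 | h1
  · have h2 : t < m := by
      rw [sign_neg (sub_neg.2 h1)] at h
      exact sub_neg.1 (sign_eq_neg_one_iff.1 h.symm)
    have := aux' hs h1
    have := aux' ht h2
    omega
  · have h2 : t = m := by
      rw [h1, sub_self, sign_zero] at h
      exact sub_eq_zero.1 (sign_eq_zero_iff.1 h.symm)
    rw [h1, h2]
    exact ⟨rfl, rfl⟩
  · have h2 : (m : ℝ) < t := by
      rw [sign_pos (sub_pos.2 h1)] at h
      exact sub_pos.1 (sign_eq_one_iff.1 h.symm)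
    have := aux hs h1
    have := aux ht h2
    omega

/-! ### The lifted arrangement -/

section Lifted

variable {d n : ℕ} (A : Matrix (Fin d) (Fin n) ℤ) (b : Fin n → UnitAddCircle)

/-- The linear form given by a column, bundled. -/
def columnLin (j : Fin n) : EuclideanSpace ℝ (Fin d) →ₗ[ℝ] ℝ where
  toFun := columnForm A j
  map_add' := columnForm_add A j
  map_smul' c x := by
    simp only [columnForm, PiLp.smul_apply, smul_eq_mul, RingHom.id_apply, Finset.mul_sum]
    exact Finset.sum_congr rfl fun k _ => by ring

theorem columnForm_sub (j : Fin n) (x y : EuclideanSpace ℝ (Fin d)) :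
    columnForm A j (x - y) = columnForm A j x - columnForm A j y := map_sub (columnLin A j) x y

theorem columnForm_smul (j : Fin n) (c : ℝ) (x : EuclideanSpace ℝ (Fin d)) :
    columnForm A j (c • x) = c * columnForm A j x := map_smul (columnLin A j) c x

theorem continuous_columnForm (j : Fin n) : Continuous (columnForm A j) :=
  (columnLin A j).continuous_of_finiteDimensional

/-- A real number with class `b j`. -/
noncomputable def offset (j : Fin n) : ℝ := (QuotientAddGroup.mk_surjective (b j)).choose

theorem coe_offset (j : Fin n) : ((offset b j : ℝ) : UnitAddCircle) = b j :=
  (QuotientAddGroup.mk_surjective (b j)).choose_spec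

theorem coe_eq_iff (j : Fin n) (β : ℝ) :
    (β : UnitAddCircle) = b j ↔ ∃ m : ℤ, β - offset b j = m := by
  rw [← coe_offset b j, ← sub_eq_zero, ← AddCircle.coe_sub, AddCircle.coe_eq_zero_iff]
  simp [eq_comm]

/-- The position of a point relative to the hyperplanes of index `j`, which are the sets where
it takes integral values. -/
noncomputable def height (j : Fin n) (x : EuclideanSpace ℝ (Fin d)) : ℝ :=
  columnForm A j x - offset b j

theorem continuous_height (j : Fin n) : Continuous (height A b j) :=
  (continuous_columnForm A j).sub continuous_const

theorem height_sub_height (j : Fin n) (x y : EuclideanSpace ℝ (Fin d)) :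
    height A b j x - height A b j y = columnForm A j (x - y) := by
  rw [columnForm_sub, height, height]
  ring

theorem height_add (j : Fin n) (x y : EuclideanSpace ℝ (Fin d)) :
    height A b j (x + y) = height A b j x + columnForm A j y := by
  rw [height, height, columnForm_add]
  ring

theorem height_add_latticeVec (j : Fin n) (x : EuclideanSpace ℝ (Fin d)) (v : Fin d → ℤ) :
    height A b j (x + latticeVec v) = height A b j x + (∑ k, A k j * v k : ℤ) := by
  rw [height_add, columnForm_latticeVec]

/-- In terms of `height`, the hyperplanes of index `j` are the integer levels, so the question
reduces to cells of the real line. -/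
theorem sameFace_iff {x y : EuclideanSpace ℝ (Fin d)} : SameFace A b x y ↔
    ∀ j, ⌊height A b j x⌋ = ⌊height A b j y⌋ ∧ ⌈height A b j x⌉ = ⌈height A b j y⌉ := by
  refine forall_congr' fun j => ?_
  rw [← sign_sub_eq_iff]
  constructor
  · intro h m
    have := h (offset b j + m) ((coe_eq_iff b j _).2 ⟨m, by ring⟩)
    rwa [← sub_sub, ← sub_sub] at this
  · intro h β hβ
    obtain ⟨m, hm⟩ := (coe_eq_iff b j β).1 hβ
    have := h m
    rw [← hm, height, height] at this
    rwa [sub_sub_sub_cancel_right, sub_sub_sub_cancel_right] at this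

theorem SameFace.symm {x y : EuclideanSpace ℝ (Fin d)} (h : SameFace A b x y) :
    SameFace A b y x := fun j β hβ => (h j β hβ).symm

/-- The closed face of the lifted arrangement that contains `x` in its relative interior. -/
def closedFace (x : EuclideanSpace ℝ (Fin d)) : Set (EuclideanSpace ℝ (Fin d)) :=
  {z | ∀ j, Incident (height A b j x) (height A b j z)}

theorem self_mem_closedFace (x : EuclideanSpace ℝ (Fin d)) : x ∈ closedFace A b x :=
  fun _ => Incident.refl _

variable {A b} in
theorem closedFace_trans {x y z : EuclideanSpace ℝ (Fin d)} (h : y ∈ closedFace A b x)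
    (h' : z ∈ closedFace A b y) : z ∈ closedFace A b x := fun j => (h j).trans (h' j)

variable {A b} in
theorem SameFace.mem_closedFace {x y : EuclideanSpace ℝ (Fin d)} (h : SameFace A b x y) :
    y ∈ closedFace A b x := fun j => incident_of_floor_eq_ceil_eq ((sameFace_iff A b).1 h j)

variable {A b} in
theorem add_latticeVec_mem_closedFace {x y : EuclideanSpace ℝ (Fin d)}
    (h : y ∈ closedFace A b x) (v : Fin d → ℤ) :
    y + latticeVec v ∈ closedFace A b (x + latticeVec v) := fun j => by
  rw [height_add_latticeVec, height_add_latticeVec]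
  exact (h j).add_intCast _

theorem isClosed_closedFace (x : EuclideanSpace ℝ (Fin d)) : IsClosed (closedFace A b x) := by
  have : closedFace A b x =
      ⋂ j, height A b j ⁻¹' Set.Icc (⌊height A b j x⌋ : ℝ) ⌈height A b j x⌉ := by
    ext z
    simp [closedFace, Incident]
  rw [this]
  exact isClosed_iInter fun j => isClosed_Icc.preimage (continuous_height A b j)

theorem convex_closedFace (x : EuclideanSpace ℝ (Fin d)) : Convex ℝ (closedFace A b x) := by
  have : closedFace A b x = ⋂ j, columnLin A j ⁻¹' Set.Icc
      (⌊height A b j x⌋ + offset b j : ℝ) (⌈height A b j x⌉ + offset b j) := by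
    ext z
    simp [closedFace, Incident, columnLin, height, le_sub_iff_add_le]
  rw [this]
  exact convex_iInter fun j => (convex_Icc _ _).linear_preimage _

/-- The segment from a point of the closed face towards `x` enters the open face at once. -/
theorem closure_liftedFace (x : EuclideanSpace ℝ (Fin d)) :
    closure (liftedFace A b x) = closedFace A b x := by
  refine (closure_minimal (fun y hy => SameFace.mem_closedFace hy)
    (isClosed_closedFace A b x)).antisymm fun z hz => ?_
  have hc : Continuous fun θ : ℝ => z + θ • (x - z) := by fun_prop
  have h0 : Filter.Tendsto (fun θ : ℝ => z + θ • (x - z)) (nhdsWithin 0 (Set.Ioi 0)) (nhds z) := by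
    have := hc.tendsto 0
    rw [zero_smul, add_zero] at this
    exact this.mono_left nhdsWithin_le_nhds
  refine mem_closure_of_tendsto h0 ?_
  filter_upwards [Ioc_mem_nhdsGT (zero_lt_one (α := ℝ))] with θ hθ
  refine (sameFace_iff A b).2 fun j => ?_
  have e : height A b j (z + θ • (x - z)) =
      height A b j z + θ * (height A b j x - height A b j z) := by
    rw [height_add, columnForm_smul, height_sub_height]
  rw [e]
  exact (hz j).segment hθ.1 hθ.2

theorem eventually_mem_closedFace (x : EuclideanSpace ℝ (Fin d)) :
    ∀ᶠ y in nhds x, x ∈ closedFace A b y :=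
  Filter.eventually_all.2 fun j =>
    ((continuous_height A b j).tendsto x).eventually (eventually_incident _)

/-- The point `x` lies on a hyperplane of index `j`. -/
def Active (x : EuclideanSpace ℝ (Fin d)) (j : Fin n) : Prop :=
  ((columnForm A j x : ℝ) : UnitAddCircle) = b j

theorem active_iff {x : EuclideanSpace ℝ (Fin d)} {j : Fin n} :
    Active A b x j ↔ ∃ m : ℤ, height A b j x = m := coe_eq_iff b j _

theorem active_add_latticeVec {x : EuclideanSpace ℝ (Fin d)} {j : Fin n} (v : Fin d → ℤ) :
    Active A b (x + latticeVec v) j ↔ Active A b x j := by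
  rw [active_iff, active_iff, height_add_latticeVec]
  constructor
  · rintro ⟨m, hm⟩
    exact ⟨m - ∑ k, A k j * v k, by push_cast at hm ⊢; linarith⟩
  · rintro ⟨m, hm⟩
    exact ⟨m + ∑ k, A k j * v k, by push_cast; linarith⟩

variable {A b}

theorem height_eq_of_active {x y : EuclideanSpace ℝ (Fin d)} (h : y ∈ closedFace A b x)
    {j : Fin n} (hj : Active A b x j) : height A b j y = height A b j x := by
  obtain ⟨m, hm⟩ := (active_iff A b).1 hj
  have := h j
  rw [hm] at this ⊢
  exact this.eq_of_intCast

/-- The hyperplanes through `x` are those through `y` that contain the direction `x - y`. On the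
zonotope side, these are the columns left free on the face selected by `x - y`. -/
theorem active_iff_of_mem_closedFace {x y : EuclideanSpace ℝ (Fin d)}
    (h : y ∈ closedFace A b x) {j : Fin n} :
    Active A b x j ↔ Active A b y j ∧ columnForm A j (x - y) = 0 := by
  rw [← height_sub_height A b, sub_eq_zero]
  constructor
  · intro hj
    have e := height_eq_of_active h hj
    refine ⟨?_, e.symm⟩
    rw [active_iff, e]
    exact (active_iff A b).1 hj
  · rintro ⟨hj, e⟩
    rw [active_iff, e]
    exact (active_iff A b).1 hj

theorem floor_ceil_eq_of_not_active {x y : EuclideanSpace ℝ (Fin d)}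
    (h : y ∈ closedFace A b x) {j : Fin n} (hj : ¬ Active A b y j) :
    ⌊height A b j x⌋ = ⌊height A b j y⌋ ∧ ⌈height A b j x⌉ = ⌈height A b j y⌉ :=
  (h j).floor_eq_ceil_eq fun m hm => hj ((active_iff A b).2 ⟨m, hm⟩)

/-- Around `x` only the active hyperplanes matter, so a face with `x` in its closure is determined
by its signs with respect to them. -/
theorem sameFace_of_mem_closedFace {x y z : EuclideanSpace ℝ (Fin d)}
    (hy : x ∈ closedFace A b y) (hz : x ∈ closedFace A b z)
    (h : ∀ j, Active A b x j →
      SignType.sign (columnForm A j (y - x)) = SignType.sign (columnForm A j (z - x))) :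
    SameFace A b y z := by
  refine (sameFace_iff A b).2 fun j => ?_
  by_cases hj : Active A b x j
  · have := h j hj
    obtain ⟨m, hm⟩ := (active_iff A b).1 hj
    have h1 := hy j
    have h2 := hz j
    rw [← height_sub_height A b, ← height_sub_height A b, hm] at this
    rw [hm] at h1 h2
    exact floor_ceil_eq_of_sign_eq h1 h2 this
  · have h1 := floor_ceil_eq_of_not_active hy hj
    have h2 := floor_ceil_eq_of_not_active hz hj
    exact ⟨h1.1.trans h2.1.symm, h1.2.trans h2.2.symm⟩

theorem SameFace.sign_eq {x y z : EuclideanSpace ℝ (Fin d)} (h : SameFace A b y z) {j : Fin n}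
    (hj : Active A b x j) :
    SignType.sign (columnForm A j (y - x)) = SignType.sign (columnForm A j (z - x)) := by
  rw [columnForm_sub, columnForm_sub]
  exact h j _ hj

/-- Signs are additive along chains of faces. -/
theorem sign_columnForm_of_chain {x y z : EuclideanSpace ℝ (Fin d)}
    (hy : y ∈ closedFace A b z) {j : Fin n} (hj : Active A b x j) (hj' : ¬ Active A b y j) :
    SignType.sign (columnForm A j (z - x)) = SignType.sign (columnForm A j (y - x)) := by
  obtain ⟨m, hm⟩ := (active_iff A b).1 hj
  rw [← height_sub_height A b, ← height_sub_height A b, hm]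
  exact sign_sub_eq_iff.2 (floor_ceil_eq_of_not_active hy hj') m

theorem vectorSpan_closedFace_le {x : EuclideanSpace ℝ (Fin d)} {j : Fin n}
    (hj : Active A b x j) :
    vectorSpan ℝ (closedFace A b x) ≤ LinearMap.ker (columnLin A j) := by
  rw [vectorSpan_def, Submodule.span_le]
  rintro _ ⟨p, hp, q, hq, rfl⟩
  change columnForm A j (p - q) = 0
  rw [← height_sub_height A b, height_eq_of_active hp hj, height_eq_of_active hq hj, sub_self]

/-- Active heights are constant on the affine span, and the remaining inequalities are strict at
`x`, hence open conditions. -/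
theorem mem_intrinsicInterior_closedFace (x : EuclideanSpace ℝ (Fin d)) :
    x ∈ intrinsicInterior ℝ (closedFace A b x) := by
  refine mem_intrinsicInterior.2
    ⟨⟨x, subset_affineSpan ℝ _ (self_mem_closedFace A b x)⟩, ?_, rfl⟩
  have hspan : ∀ y ∈ affineSpan ℝ (closedFace A b x), ∀ j, Active A b x j →
      height A b j y = height A b j x := by
    intro y hy j hj
    have h1 : y -ᵥ x ∈ vectorSpan ℝ (closedFace A b x) := by
      rw [← direction_affineSpan]
      exact AffineSubspace.vsub_mem_direction hy
        (subset_affineSpan ℝ _ (self_mem_closedFace A b x))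
    have h3 : columnForm A j (y - x) = 0 := vectorSpan_closedFace_le hj h1
    rwa [← height_sub_height A b, sub_eq_zero] at h3
  have hopen : ∀ j, IsOpen {y : affineSpan ℝ (closedFace A b x) |
      (⌊height A b j x⌋ : ℝ) < height A b j y ∧ height A b j y < ⌈height A b j x⌉} := fun j =>
    isOpen_Ioo.preimage ((continuous_height A b j).comp continuous_subtype_val)
  refine interior_maximal (t := ⋂ j, ⋂ _ : ¬ Active A b x j,
    {y : affineSpan ℝ (closedFace A b x) | (⌊height A b j x⌋ : ℝ) < height A b j y ∧
      height A b j y < ⌈height A b j x⌉}) ?_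
    (isOpen_iInter_of_finite fun j => isOpen_iInter_of_finite fun _ => hopen j) ?_
  · intro y hy j
    simp only [Set.mem_iInter] at hy
    by_cases hj : Active A b x j
    · rw [hspan y y.2 j hj]
      exact Incident.refl _
    · exact ⟨(hy j hj).1.le, (hy j hj).2.le⟩
  · simp only [Set.mem_iInter]
    intro j hj
    rw [active_iff] at hj
    push Not at hj
    exact ⟨lt_of_le_of_ne (Int.floor_le _) (hj _).symm, lt_of_le_of_ne (Int.le_ceil _) (hj _)⟩

/-- A small step from `x` along a direction annihilated by the active forms stays in the same open
face. -/
theorem vectorSpan_closedFace (x : EuclideanSpace ℝ (Fin d)) :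
    (vectorSpan ℝ (closedFace A b x) : Set (EuclideanSpace ℝ (Fin d))) =
      {v | ∀ j, Active A b x j → columnForm A j v = 0} := by
  ext v
  constructor
  · intro hv j hj
    exact vectorSpan_closedFace_le hj hv
  · intro hv
    have hc : Filter.Tendsto (fun ε : ℝ => x + ε • v) (nhdsWithin 0 (Set.Ioi 0)) (nhds x) := by
      have : Continuous fun ε : ℝ => x + ε • v := by fun_prop
      have := this.tendsto 0
      rw [zero_smul, add_zero] at this
      exact this.mono_left nhdsWithin_le_nhds
    obtain ⟨ε, h1, h2⟩ := ((hc.eventually (eventually_mem_closedFace A b x)).and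
      self_mem_nhdsWithin).exists
    have h3 : SameFace A b (x + ε • v) x :=
      sameFace_of_mem_closedFace h1 (self_mem_closedFace A b x) fun j hj => by
        rw [add_sub_cancel_left, columnForm_smul, hv j hj, mul_zero, sub_self]
        exact congrArg _ (map_zero (columnLin A j)).symm
    have h4 := vsub_mem_vectorSpan ℝ (SameFace.mem_closedFace (SameFace.symm A b h3))
      (self_mem_closedFace A b x)
    rw [vsub_eq_sub, add_sub_cancel_left] at h4
    exact ((vectorSpan ℝ _).smul_mem_iff (ne_of_gt h2)).1 h4

theorem isFace_closedFace {x y : EuclideanSpace ℝ (Fin d)} (h : y ∈ closedFace A b x) :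
    IsFace (closedFace A b x) (closedFace A b y) := by
  classical
  -- The coefficient is `1` if `y` attains only the lower bound, `-1` if only the upper one, and `0`
  -- if neither or both. Each summand of `ℓ z - ℓ y` is then nonnegative on the closed face of `x`.
  let s : Fin n → ℝ := fun j => (if height A b j y = ⌊height A b j x⌋ then 1 else 0) -
    (if height A b j y = ⌈height A b j x⌉ then 1 else 0)
  let ℓ : EuclideanSpace ℝ (Fin d) →ₗ[ℝ] ℝ := ∑ j, s j • columnLin A j
  have hℓ : ∀ z, ℓ z - ℓ y = ∑ j, s j * (height A b j z - height A b j y) := by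
    intro z
    simp only [ℓ, LinearMap.sum_apply, LinearMap.smul_apply, smul_eq_mul, columnLin,
      LinearMap.coe_mk, AddHom.coe_mk, ← Finset.sum_sub_distrib, height]
    exact Finset.sum_congr rfl fun j _ => by ring
  have hnn : ∀ z ∈ closedFace A b x, ∀ j, 0 ≤ s j * (height A b j z - height A b j y) := by
    intro z hz j
    obtain ⟨h1, h2⟩ := hz j
    simp only [s]
    split_ifs with a c c
    · simp
    · rw [sub_zero, one_mul, a]
      linarith
    · rw [c]
      linarith
    · simp
  refine ⟨⟨y, self_mem_closedFace A b y⟩, ℓ, ℓ y, ?_, ?_⟩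
  · intro z hz
    have := Finset.sum_nonneg fun j (_ : j ∈ Finset.univ) => hnn z hz j
    rw [← hℓ] at this
    linarith
  · ext z
    constructor
    · intro hz
      refine ⟨closedFace_trans h hz, ?_⟩
      rw [← sub_eq_zero, hℓ]
      refine Finset.sum_eq_zero fun j _ => ?_
      by_cases hj : Active A b y j
      · rw [height_eq_of_active hz hj, sub_self, mul_zero]
      · rw [active_iff] at hj
        push Not at hj
        simp [s, hj]
    · rintro ⟨hz, he⟩ j
      rw [← sub_eq_zero, hℓ, Finset.sum_eq_zero_iff_of_nonneg fun j _ => hnn z hz j] at he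
      have hej := he j (Finset.mem_univ j)
      by_cases hj : Active A b y j
      · suffices height A b j z = height A b j y by
          rw [this]
          exact Incident.refl _
        obtain ⟨m, hm⟩ := (active_iff A b).1 hj
        by_cases hx : Active A b x j
        · rw [height_eq_of_active hz hx, height_eq_of_active h hx]
        · rw [active_iff] at hx
          push Not at hx
          have hne : ⌊height A b j x⌋ ≠ ⌈height A b j x⌉ := by
            intro e
            refine hx ⌊height A b j x⌋ (le_antisymm ?_ (Int.floor_le _))
            rw [e]
            exact Int.le_ceil _
          have hj' := h j
          rw [hm] at hj'
          have hs : s j ≠ 0 := by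
            simp only [s, hm, Int.cast_inj]
            rcases hj'.eq_floor_or_eq_ceil with rfl | rfl
            · simp [hne]
            · simp [hne.symm]
          exact sub_eq_zero.1 ((mul_eq_zero.1 hej).resolve_left hs)
      · obtain ⟨h1, h2⟩ := floor_ceil_eq_of_not_active h hj
        have := hz j
        rw [Incident] at this ⊢
        rwa [← h1, ← h2]

/-- Take `y` in the relative interior of `T`. Then `T` and the closed face of `y` are faces sharing
a relative interior point. -/
theorem exists_eq_closedFace {x : EuclideanSpace ℝ (Fin d)} {T : Set (EuclideanSpace ℝ (Fin d))}
    (hT : IsFace (closedFace A b x) T) : ∃ y ∈ closedFace A b x, T = closedFace A b y := by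
  obtain ⟨y, hy⟩ := Set.Nonempty.intrinsicInterior
    (IsFace.convex (convex_closedFace A b x) hT) hT.1
  have hyx := hT.subset (intrinsicInterior_subset hy)
  exact ⟨y, hyx, hT.eq_of_mem_intrinsicInterior (isFace_closedFace hyx) hy
    (mem_intrinsicInterior_closedFace y)⟩

end Lifted

/-! ### Zonotopes and their faces -/

section Zonotopes

variable {d n : ℕ} (A : Matrix (Fin d) (Fin n) ℤ)

/-- The `j`-th column, as a vector of `ℝ^d`. -/
noncomputable def colVec (j : Fin n) : EuclideanSpace ℝ (Fin d) :=
  WithLp.toLp 2 fun k => (A k j : ℝ)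

theorem inner_colVec (j : Fin n) (w : EuclideanSpace ℝ (Fin d)) :
    inner ℝ w (colVec A j) = columnForm A j w := by
  simp [colVec, columnForm, PiLp.inner_apply]

/-- The linear combination of the columns with given coefficients. -/
noncomputable def colSum : (Fin n → ℝ) →ₗ[ℝ] EuclideanSpace ℝ (Fin d) :=
  Fintype.linearCombination ℝ (colVec A)

theorem colSum_apply (t : Fin n → ℝ) : colSum A t = ∑ j, t j • colVec A j := rfl

theorem inner_colSum (t : Fin n → ℝ) (w : EuclideanSpace ℝ (Fin d)) :
    inner ℝ w (colSum A t) = ∑ j, t j * columnForm A j w := by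
  rw [colSum_apply, inner_sum]
  exact Finset.sum_congr rfl fun j _ => by rw [inner_smul_right, inner_colVec]

/-- The cube of the coefficients of the points of a zonotope. -/
def coeffCube (J : Set (Fin n)) : Set (Fin n → ℝ) :=
  {t | (∀ j, t j ∈ Set.Icc (-1 : ℝ) 1) ∧ ∀ j, j ∉ J → t j = 0}

/-- The zonotope spanned by the columns with index in `J`. -/
def columnZonotope (J : Set (Fin n)) : Set (EuclideanSpace ℝ (Fin d)) :=
  colSum A '' coeffCube J

/-- The face of a zonotope on which the scalar product with `w` is maximal. -/
def zonotopeFace (J : Set (Fin n)) (w : EuclideanSpace ℝ (Fin d)) :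
    Set (EuclideanSpace ℝ (Fin d)) :=
  colSum A '' {t ∈ coeffCube J | ∀ j ∈ J, columnForm A j w ≠ 0 →
    t j = SignType.sign (columnForm A j w)}

open Classical in
/-- The signs of the columns with index in `J` at `w`. -/
noncomputable def signVec (J : Set (Fin n)) (w : EuclideanSpace ℝ (Fin d)) (j : Fin n) : ℝ :=
  if j ∈ J then SignType.sign (columnForm A j w) else 0

theorem signVec_of_mem {J : Set (Fin n)} {j : Fin n} (hj : j ∈ J)
    (w : EuclideanSpace ℝ (Fin d)) : signVec A J w j = SignType.sign (columnForm A j w) :=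
  if_pos hj

theorem signVec_of_notMem {J : Set (Fin n)} {j : Fin n} (hj : j ∉ J)
    (w : EuclideanSpace ℝ (Fin d)) : signVec A J w j = 0 :=
  if_neg hj

theorem coe_sign_mem_Icc (s : SignType) : (s : ℝ) ∈ Set.Icc (-1 : ℝ) 1 := by
  cases s <;> norm_num

theorem signVec_mem_coeffCube (J : Set (Fin n)) (w : EuclideanSpace ℝ (Fin d)) :
    signVec A J w ∈ coeffCube J := by
  refine ⟨fun j => ?_, fun j hj => signVec_of_notMem A hj w⟩
  by_cases hj : j ∈ J
  · rw [signVec_of_mem A hj]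
    exact coe_sign_mem_Icc _
  · rw [signVec_of_notMem A hj]
    norm_num

/-- On the face selected by `w`, columns not orthogonal to `w` have coefficient fixed at `±1`, while
the orthogonal ones stay free. -/
theorem image_add_columnZonotope {J J' : Set (Fin n)} {w : EuclideanSpace ℝ (Fin d)}
    (h : ∀ j, j ∈ J' ↔ j ∈ J ∧ columnForm A j w = 0) :
    (fun p => p + colSum A (signVec A J w)) '' columnZonotope A J' = zonotopeFace A J w := by
  have hs : ∀ j ∈ J', signVec A J w j = 0 := fun j hj => by
    rw [signVec_of_mem A ((h j).1 hj).1, ((h j).1 hj).2]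
    simp
  ext y
  constructor
  · rintro ⟨_, ⟨t, ht, rfl⟩, rfl⟩
    refine ⟨t + signVec A J w, ⟨⟨fun j => ?_, fun j hj => ?_⟩, fun j hj hw => ?_⟩, map_add _ _ _⟩
    · by_cases hj : j ∈ J'
      · rw [Pi.add_apply, hs j hj, add_zero]
        exact ht.1 j
      · rw [Pi.add_apply, ht.2 j hj, zero_add]
        exact (signVec_mem_coeffCube A J w).1 j
    · rw [Pi.add_apply, signVec_of_notMem A hj, ht.2 j fun h' => hj ((h j).1 h').1, add_zero]
    · rw [Pi.add_apply, signVec_of_mem A hj, ht.2 j fun h' => hw ((h j).1 h').2, zero_add]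
  · rintro ⟨t, ⟨ht, ht'⟩, rfl⟩
    refine ⟨colSum A (t - signVec A J w), ⟨t - signVec A J w, ⟨fun j => ?_, fun j hj => ?_⟩, rfl⟩,
      by simp only [map_sub, sub_add_cancel]⟩
    · by_cases hj : j ∈ J'
      · rw [Pi.sub_apply, hs j hj, sub_zero]
        exact ht.1 j
      · have : t j - signVec A J w j = 0 := by
          by_cases hJ : j ∈ J
          · rw [signVec_of_mem A hJ, ht' j hJ fun h' => hj ((h j).2 ⟨hJ, h'⟩), sub_self]
          · rw [signVec_of_notMem A hJ, ht.2 j hJ, sub_self]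
        rw [Pi.sub_apply, this]
        norm_num
    · by_cases hJ : j ∈ J
      · rw [Pi.sub_apply, signVec_of_mem A hJ, ht' j hJ fun h' => hj ((h j).2 ⟨hJ, h'⟩), sub_self]
      · rw [Pi.sub_apply, signVec_of_notMem A hJ, ht.2 j hJ, sub_self]

theorem mul_le_abs_of_mem_Icc {t r : ℝ} (ht : t ∈ Set.Icc (-1 : ℝ) 1) : t * r ≤ |r| := by
  have h := abs_le.2 ht
  calc t * r ≤ |t * r| := le_abs_self _
    _ = |t| * |r| := abs_mul t r
    _ ≤ 1 * |r| := mul_le_mul_of_nonneg_right h (abs_nonneg r)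
    _ = |r| := one_mul _

theorem mul_eq_abs_iff {t r : ℝ} : t * r = |r| ↔ (r ≠ 0 → t = SignType.sign r) := by
  rw [← sign_mul_self]
  constructor
  · exact fun h hr => mul_right_cancel₀ hr h
  · intro h
    by_cases hr : r = 0
    · rw [hr, mul_zero, mul_zero]
    · rw [h hr]

theorem inner_signVec_sub_nonneg {J : Set (Fin n)} {t : Fin n → ℝ} (ht : t ∈ coeffCube J)
    (w : EuclideanSpace ℝ (Fin d)) (j : Fin n) :
    0 ≤ signVec A J w j * columnForm A j w - t j * columnForm A j w := by
  by_cases hj : j ∈ J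
  · rw [signVec_of_mem A hj, sign_mul_self, sub_nonneg]
    exact mul_le_abs_of_mem_Icc (ht.1 j)
  · rw [signVec_of_notMem A hj, ht.2 j hj, sub_self]

theorem inner_colSum_le {J : Set (Fin n)} {t : Fin n → ℝ} (ht : t ∈ coeffCube J)
    (w : EuclideanSpace ℝ (Fin d)) :
    inner ℝ w (colSum A t) ≤ inner ℝ w (colSum A (signVec A J w)) := by
  rw [inner_colSum, inner_colSum]
  exact Finset.sum_le_sum fun j _ => sub_nonneg.1 (inner_signVec_sub_nonneg A ht w j)

theorem inner_colSum_eq_iff {J : Set (Fin n)} {t : Fin n → ℝ} (ht : t ∈ coeffCube J)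
    (w : EuclideanSpace ℝ (Fin d)) :
    inner ℝ w (colSum A t) = inner ℝ w (colSum A (signVec A J w)) ↔
      ∀ j ∈ J, columnForm A j w ≠ 0 → t j = SignType.sign (columnForm A j w) := by
  rw [eq_comm, ← sub_eq_zero, inner_colSum, inner_colSum, ← Finset.sum_sub_distrib,
    Finset.sum_eq_zero_iff_of_nonneg fun j _ => inner_signVec_sub_nonneg A ht w j]
  refine forall_congr' fun j => ?_
  by_cases hj : j ∈ J
  · simp only [Finset.mem_univ, forall_const, hj, signVec_of_mem A hj]
    rw [sign_mul_self, sub_eq_zero, eq_comm, mul_eq_abs_iff]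
  · simp [hj, signVec_of_notMem A hj, ht.2 j hj]

theorem zonotopeFace_eq (J : Set (Fin n)) (w : EuclideanSpace ℝ (Fin d)) :
    zonotopeFace A J w = {y ∈ columnZonotope A J |
      inner ℝ w y = inner ℝ w (colSum A (signVec A J w))} := by
  ext y
  constructor
  · rintro ⟨t, ⟨ht, h⟩, rfl⟩
    exact ⟨⟨t, ht, rfl⟩, (inner_colSum_eq_iff A ht w).2 h⟩
  · rintro ⟨⟨t, ht, rfl⟩, h⟩
    exact ⟨t, ⟨ht, (inner_colSum_eq_iff A ht w).1 h⟩, rfl⟩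

theorem isFace_zonotopeFace (J : Set (Fin n)) (w : EuclideanSpace ℝ (Fin d)) :
    IsFace (columnZonotope A J) (zonotopeFace A J w) := by
  refine ⟨⟨_, signVec A J w, ⟨signVec_mem_coeffCube A J w, fun j hj _ =>
    signVec_of_mem A hj w⟩, rfl⟩, -(innerₗ _ w), -inner ℝ w (colSum A (signVec A J w)), ?_, ?_⟩
  · rintro _ ⟨t, ht, rfl⟩
    exact neg_le_neg (inner_colSum_le A ht w)
  · rw [zonotopeFace_eq]
    ext y
    exact and_congr_right fun _ => neg_inj.symm

theorem exists_eq_zonotopeFace {J : Set (Fin n)} {T : Set (EuclideanSpace ℝ (Fin d))}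
    (hT : IsFace (columnZonotope A J) T) : ∃ w, T = zonotopeFace A J w := by
  obtain ⟨⟨y₀, hy₀⟩, ℓ, c, hc, rfl⟩ := hT
  -- Riesz representation, with a sign because `IsFace` minimizes `ℓ` while `zonotopeFace` maximizes
  -- the inner product with `w`.
  let w := -(InnerProductSpace.toDual ℝ (EuclideanSpace ℝ (Fin d))).symm ℓ.toContinuousLinearMap
  have hw : ∀ y, inner ℝ w y = -ℓ y := fun y => by
    rw [inner_neg_left, InnerProductSpace.toDual_symm_apply]
    rfl
  refine ⟨w, ?_⟩
  have hM : inner ℝ w (colSum A (signVec A J w)) = -c := by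
    refine le_antisymm ?_ ?_
    · rw [hw]
      exact neg_le_neg (hc _ ⟨_, signVec_mem_coeffCube A J w, rfl⟩)
    · obtain ⟨⟨t, ht, rfl⟩, h⟩ := hy₀
      rw [← h, ← hw]
      exact inner_colSum_le A ht w
  rw [zonotopeFace_eq, hM]
  ext y
  refine and_congr_right fun _ => ?_
  rw [hw, neg_inj]

/-- The signed column sum of `w` lies in the face of `w'`, and maximality for `w'` forces its
coefficients wherever `w'` is not orthogonal to the column. -/
theorem sign_eq_of_zonotopeFace_subset {J : Set (Fin n)} {w w' : EuclideanSpace ℝ (Fin d)}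
    (h : zonotopeFace A J w ⊆ zonotopeFace A J w') {j : Fin n} (hj : j ∈ J)
    (hw' : columnForm A j w' ≠ 0) :
    SignType.sign (columnForm A j w) = SignType.sign (columnForm A j w') := by
  have h1 : colSum A (signVec A J w) ∈ zonotopeFace A J w :=
    ⟨_, ⟨signVec_mem_coeffCube A J w, fun j hj _ => signVec_of_mem A hj w⟩, rfl⟩
  have h2 := h h1
  rw [zonotopeFace_eq] at h2
  have h3 := (inner_colSum_eq_iff A (signVec_mem_coeffCube A J w) w').1 h2.2 j hj hw'
  rw [signVec_of_mem A hj] at h3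
  revert h3
  generalize SignType.sign (columnForm A j w) = s
  generalize SignType.sign (columnForm A j w') = s'
  cases s <;> cases s' <;> norm_num

/-- A face of a zonotope determines the signs of the linear forms that define it. -/
theorem sign_eq_of_zonotopeFace_eq {J : Set (Fin n)} {w w' : EuclideanSpace ℝ (Fin d)}
    (h : zonotopeFace A J w = zonotopeFace A J w') {j : Fin n} (hj : j ∈ J) :
    SignType.sign (columnForm A j w) = SignType.sign (columnForm A j w') := by
  by_cases h1 : columnForm A j w' = 0
  · by_cases h2 : columnForm A j w = 0
    · rw [h1, h2]
    · exact (sign_eq_of_zonotopeFace_subset A h.symm.subset hj h2).symm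
  · exact sign_eq_of_zonotopeFace_subset A h.subset hj h1

theorem zonotopeFace_congr {J : Set (Fin n)} {w w' : EuclideanSpace ℝ (Fin d)}
    (h : ∀ j ∈ J, SignType.sign (columnForm A j w) = SignType.sign (columnForm A j w')) :
    zonotopeFace A J w = zonotopeFace A J w' := by
  unfold zonotopeFace
  congr 1
  ext t
  refine and_congr_right fun _ => forall₂_congr fun j hj => ?_
  rw [← sign_ne_zero, ← sign_ne_zero (a := columnForm A j w'), h j hj]

theorem isPolytope_columnZonotope (J : Set (Fin n)) : IsPolytope (columnZonotope A J) := by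
  classical
  let u : Fin n → Set ℝ := fun j => if j ∈ J then {-1, 1} else {0}
  have hu : ∀ j, (u j).Finite := fun j => by
    simp only [u]
    split_ifs
    · exact Set.toFinite _
    · exact Set.finite_singleton _
  have hu' : ∀ j, (u j).Nonempty := fun j => by
    simp only [u]
    split_ifs
    · exact ⟨1, by simp⟩
    · exact ⟨0, rfl⟩
  have hcube : coeffCube J = convexHull ℝ (Set.univ.pi u) := by
    rw [convexHull_pi]
    ext t
    simp only [coeffCube, Set.mem_ofPred_eq, Set.mem_pi, Set.mem_univ, forall_const]
    rw [← forall_and]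
    refine forall_congr' fun j => ?_
    by_cases hj : j ∈ J
    · simp only [u, hj, if_true, convexHull_pair, not_true_eq_false, false_imp_iff, and_true]
      rw [segment_eq_Icc (by norm_num)]
    · simp only [u, hj, if_false, convexHull_singleton, not_false_eq_true, forall_const,
        Set.mem_singleton_iff]
      constructor
      · exact fun h => h.2
      · intro h
        rw [h]
        norm_num
  exact ⟨colSum A '' Set.univ.pi u, (Set.Finite.pi' hu).subset (by
      intro t ht j
      exact ht j trivial) |>.image _, (Set.univ_pi_nonempty_iff.2 hu').image _, by
    rw [columnZonotope, hcube, LinearMap.image_convexHull]⟩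

theorem vectorSpan_columnZonotope (J : Set (Fin n)) :
    vectorSpan ℝ (columnZonotope A J) = Submodule.span ℝ (colVec A '' J) := by
  classical
  refine le_antisymm ?_ ?_
  · rw [vectorSpan_def, Submodule.span_le]
    have h : ∀ t ∈ coeffCube J, colSum A t ∈ Submodule.span ℝ (colVec A '' J) := by
      intro t ht
      rw [colSum_apply]
      refine Submodule.sum_mem _ fun j _ => ?_
      by_cases hj : j ∈ J
      · exact Submodule.smul_mem _ _ (Submodule.subset_span ⟨j, hj, rfl⟩)
      · rw [ht.2 j hj, zero_smul]
        exact Submodule.zero_mem _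
    rintro _ ⟨_, ⟨t, ht, rfl⟩, _, ⟨t', ht', rfl⟩, rfl⟩
    exact Submodule.sub_mem _ (h t ht) (h t' ht')
  · rw [Submodule.span_le]
    rintro _ ⟨j, hj, rfl⟩
    have h0 : (0 : EuclideanSpace ℝ (Fin d)) ∈ columnZonotope A J :=
      ⟨0, ⟨fun j => by norm_num, fun j _ => rfl⟩, map_zero _⟩
    have h1 : colVec A j ∈ columnZonotope A J := by
      refine ⟨Pi.single j 1, ⟨fun i => ?_, fun i hi => ?_⟩, ?_⟩
      · by_cases h : i = j
        · subst h
          norm_num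
        · rw [Pi.single_eq_of_ne h]
          norm_num
      · exact Pi.single_eq_of_ne (fun h : i = j => hi (by rwa [h])) _
      · rw [colSum_apply, Finset.sum_eq_single j]
        · simp
        · intro i _ hi
          rw [Pi.single_eq_of_ne hi, zero_smul]
        · simp
    have := vsub_mem_vectorSpan ℝ h1 h0
    rwa [vsub_eq_sub, sub_zero] at this

end Zonotopes

/-! ### Dimensions of products and linear images -/

section Dimension

variable {E F : Type*} [NormedAddCommGroup E] [NormedSpace ℝ E]
  [NormedAddCommGroup F] [NormedSpace ℝ F]

theorem polyDim_prod [FiniteDimensional ℝ E] [FiniteDimensional ℝ F] {P : Set E} {Q : Set F} (hP : P.Nonempty) (hQ : Q.Nonempty) :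
    polyDim (P ×ˢ Q) = polyDim P + polyDim Q := by
  have h : vectorSpan ℝ (P ×ˢ Q) = (vectorSpan ℝ P).prod (vectorSpan ℝ Q) := by
    refine le_antisymm (vectorSpan_prod_le P Q) ?_
    obtain ⟨p, hp⟩ := hP
    obtain ⟨q, hq⟩ := hQ
    have h1 : vectorSpan ℝ P ≤ (vectorSpan ℝ (P ×ˢ Q)).comap (LinearMap.inl ℝ E F) := by
      rw [vectorSpan_def ℝ P, Submodule.span_le]
      rintro _ ⟨x, hx, y, hy, rfl⟩
      have := vsub_mem_vectorSpan ℝ (Set.mk_mem_prod hx hq) (Set.mk_mem_prod hy hq)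
      simpa using this
    have h2 : vectorSpan ℝ Q ≤ (vectorSpan ℝ (P ×ˢ Q)).comap (LinearMap.inr ℝ E F) := by
      rw [vectorSpan_def ℝ Q, Submodule.span_le]
      rintro _ ⟨x, hx, y, hy, rfl⟩
      have := vsub_mem_vectorSpan ℝ (Set.mk_mem_prod hp hx) (Set.mk_mem_prod hp hy)
      simpa using this
    rintro ⟨u, v⟩ ⟨hu, hv⟩
    have := Submodule.add_mem (vectorSpan ℝ (P ×ˢ Q)) (h1 hu) (h2 hv)
    simpa using this
  let f := (vectorSpan ℝ P).subtype.prodMap (vectorSpan ℝ Q).subtype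
  have hf : Function.Injective f :=
    Prod.map_injective.2 ⟨Subtype.val_injective, Subtype.val_injective⟩
  have hr : LinearMap.range f = (vectorSpan ℝ P).prod (vectorSpan ℝ Q) := by
    rw [LinearMap.range_prodMap, Submodule.range_subtype, Submodule.range_subtype]
  rw [polyDim, h, ← hr, LinearMap.finrank_range_of_inj hf]
  exact Module.finrank_prod

theorem polyDim_image_equiv (L : E ≃ₗ[ℝ] F) (P : Set E) : polyDim (L '' P) = polyDim P := by
  have h := AffineMap.map_vectorSpan (k := ℝ) L.toLinearMap.toAffineMap (s := P)
  have e : vectorSpan ℝ (L '' P) = (vectorSpan ℝ P).map L.toLinearMap := h.symm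
  rw [polyDim, e]
  exact L.finrank_map_eq _

end Dimension

/-! ### The face category of a toric arrangement -/

section Toric

variable {d n : ℕ} (A : Matrix (Fin d) (Fin n) ℤ) (b : Fin n → UnitAddCircle)

theorem latticeVec_add (v w : Fin d → ℤ) :
    latticeVec (v + w) = latticeVec v + latticeVec w := by
  ext k
  simp [latticeVec]

theorem latticeVec_zero : latticeVec (0 : Fin d → ℤ) = 0 := by
  ext k
  simp [latticeVec]

theorem latticeVec_injective : Function.Injective (latticeVec (d := d)) := by
  intro v w h
  funext k
  have := congrArg (fun x : EuclideanSpace ℝ (Fin d) => x k) h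
  simpa [latticeVec] using this

variable {A} in
-- Full row rank makes the transpose injective, so vectors are determined by their values on the
-- columns.
theorem eq_zero_of_columnForm_eq_zero (hA : (A.map (Int.cast : ℤ → ℝ)).rank = d)
    {w : EuclideanSpace ℝ (Fin d)} (h : ∀ j, columnForm A j w = 0) : w = 0 := by
  rw [← Matrix.rank_transpose, Matrix.rank] at hA
  have h1 := LinearMap.finrank_range_add_finrank_ker (A.map (Int.cast : ℤ → ℝ)).transpose.mulVecLin
  rw [hA, Module.finrank_fin_fun, Nat.add_eq_left, Submodule.finrank_eq_zero] at h1
  have h2 : w.ofLp ∈ LinearMap.ker (A.map (Int.cast : ℤ → ℝ)).transpose.mulVecLin := by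
    rw [LinearMap.mem_ker]
    funext j
    exact h j
  rw [h1, Submodule.mem_bot] at h2
  exact (WithLp.ofLp_eq_zero 2).1 h2

/-- The chosen point in the relative interior of the polytope of a cell. -/
noncomputable def base (c : toricFaceCat A b) : EuclideanSpace ℝ (Fin d) :=
  Quotient.out (s := faceOrbitSetoid A b) c

theorem toricComplex_P (c : toricFaceCat A b) :
    (toricComplex A b).P c = closedFace A b (base A b c) := closure_liftedFace A b _

variable {A b} in
theorem eq_of_base_rel {c c' : toricFaceCat A b}
    (h : (faceOrbitSetoid A b) (base A b c) (base A b c')) : c = c' :=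
  (Quotient.out_eq (s := faceOrbitSetoid A b) c).symm.trans
    ((Quotient.sound h).trans (Quotient.out_eq (s := faceOrbitSetoid A b) c'))

/-- The indices of the hypersurfaces through a cell. -/
def activeSet (c : toricFaceCat A b) : Set (Fin n) := {j | Active A b (base A b c) j}

theorem torusProj_mem_hypersurface {j : Fin n} {x : EuclideanSpace ℝ (Fin d)} :
    torusProj d x ∈ hypersurface A b j ↔ Active A b x j := by
  have : ((columnForm A j x : ℝ) : UnitAddCircle) = ∑ k, A k j • ((x k : ℝ) : UnitAddCircle) := by
    have := map_sum (QuotientAddGroup.mk' (AddSubgroup.zmultiples (1 : ℝ)))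
      (fun k => (A k j : ℝ) * x k) Finset.univ
    refine this.trans (Finset.sum_congr rfl fun k _ => ?_)
    rw [← zsmul_eq_mul]
    rfl
  rw [Active, this]
  rfl

/-- The base point lies in the open cell, and active heights are constant on the closed face. This
passes from the set of hypersurfaces, where distinct indices may coincide, to a set of indices. -/
theorem hypersurface_mem_supp {c : toricFaceCat A b} {j : Fin n} :
    hypersurface A b j ∈ supp A b c ↔ j ∈ activeSet A b c := by
  have hx : base A b c ∈ intrinsicInterior ℝ (closure (liftedFace A b (base A b c))) := by
    rw [closure_liftedFace]
    exact mem_intrinsicInterior_closedFace _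
  constructor
  · rintro ⟨-, h⟩
    exact (torusProj_mem_hypersurface A b).1
      (h ⟨⟨base A b c, intrinsicInterior_subset hx⟩, hx, rfl⟩)
  · intro hj
    refine ⟨⟨j, rfl⟩, ?_⟩
    rintro _ ⟨⟨p, hp⟩, -, rfl⟩
    rw [toricComplex_P] at hp
    refine (torusProj_mem_hypersurface A b).2 ?_
    rw [active_iff, height_eq_of_active hp hj]
    exact (active_iff A b).1 hj

theorem zonotope_eq (c : toricFaceCat A b) :
    zonotope A b c = columnZonotope A (activeSet A b c) := by
  ext y
  constructor
  · rintro ⟨t, h1, h2, h3⟩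
    refine ⟨t, ⟨h1, fun j hj => h2 j fun h => hj ((hypersurface_mem_supp A b).1 h)⟩, ?_⟩
    ext k
    rw [h3, colSum_apply]
    simp [colVec]
  · rintro ⟨t, ⟨h1, h2⟩, rfl⟩
    refine ⟨t, h1, fun j hj => h2 j fun h => hj ((hypersurface_mem_supp A b).2 h), fun k => ?_⟩
    rw [colSum_apply]
    simp [colVec]

/-- The direction of the cell is the orthogonal complement of the span of its active columns. -/
theorem polyDim_zonotope (c : toricFaceCat A b) : polyDim (zonotope A b c) = codim A b c := by
  have h1 : vectorSpan ℝ (closedFace A b (base A b c)) =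
      (Submodule.span ℝ (colVec A '' activeSet A b c))ᗮ := by
    apply SetLike.coe_injective
    rw [vectorSpan_closedFace]
    ext v
    rw [SetLike.mem_coe, Submodule.mem_orthogonal']
    constructor
    · intro h u hu
      induction hu using Submodule.span_induction with
      | mem u hu =>
        obtain ⟨j, hj, rfl⟩ := hu
        rw [inner_colVec]
        exact h j hj
      | zero => exact inner_zero_right _
      | add u u' _ _ h h' => rw [inner_add_right, h, h', add_zero]
      | smul r u _ h => rw [inner_smul_right, h, mul_zero]
    · intro h j hj
      rw [← inner_colVec]
      exact h _ (Submodule.subset_span ⟨j, hj, rfl⟩)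
  have h2 := Submodule.finrank_add_finrank_orthogonal
    (Submodule.span ℝ (colVec A '' activeSet A b c))
  rw [← h1, finrank_euclideanSpace, Fintype.card_fin] at h2
  have h3 : codim A b c = d - polyDim (closedFace A b (base A b c)) :=
    congrArg (fun P => d - polyDim P) (toricComplex_P A b c)
  rw [h3, zonotope_eq, polyDim, polyDim, vectorSpan_columnZonotope]
  omega

/-! ### Face maps as lattice translations -/

variable {A b}

/-- Face maps of the toric complex are translations by lattice vectors. -/
theorem exists_latticeVec {c c' : toricFaceCat A b} (φ : c ⟶ c') :
    ∃ v : Fin d → ℤ, ∀ p : closure (liftedFace A b (base A b c)),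
      ((φ.toFun p).1 : EuclideanSpace ℝ (Fin d)) = p.1 + latticeVec v := by
  let f : closure (liftedFace A b (base A b c)) → closure (liftedFace A b (base A b c')) :=
    φ.toFun
  have hf : Continuous f := φ.isEmbedding.continuous
  have hproj : ∀ p, torusProj d (f p) = torusProj d p := fun p => φ.map_toFun p
  -- Compatibility with the covering makes each coordinate of `f p - p` an integer. Being continuous
  -- on a convex set, it is constant.
  have hint : ∀ (k : Fin d) (p), ∃ m : ℤ, (m : ℝ) = (f p).1 k - p.1 k := by
    intro k p
    have h := congrFun (hproj p) k
    change (((f p).1 k : ℝ) : UnitAddCircle) = ((p.1 k : ℝ) : UnitAddCircle) at h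
    rw [← sub_eq_zero, ← AddCircle.coe_sub, AddCircle.coe_eq_zero_iff] at h
    obtain ⟨m, hm⟩ := h
    exact ⟨m, by rw [← hm]; simp⟩
  choose m hm using hint
  have hcont : ∀ k, Continuous (m k) := by
    intro k
    rw [Int.isClosedEmbedding_coe_real.isInducing.continuous_iff]
    have : ((fun n : ℤ => (n : ℝ)) ∘ m k) = fun p => (f p).1 k - p.1 k := funext (hm k)
    rw [this]
    exact ((EuclideanSpace.proj (𝕜 := ℝ) k).continuous.comp
      (continuous_subtype_val.comp hf)).sub
      ((EuclideanSpace.proj (𝕜 := ℝ) k).continuous.comp continuous_subtype_val)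
  have : PreconnectedSpace (closure (liftedFace A b (base A b c))) := by
    refine Subtype.preconnectedSpace ?_
    rw [closure_liftedFace]
    exact (convex_closedFace A b _).isPreconnected
  have hb : base A b c ∈ closure (liftedFace A b (base A b c)) := by
    rw [closure_liftedFace]
    exact self_mem_closedFace A b _
  refine ⟨fun k => m k ⟨_, hb⟩, fun p => ?_⟩
  ext k
  have h1 := hm k p
  rw [PreconnectedSpace.constant this (hcont k) (x := p) (y := ⟨_, hb⟩)] at h1
  have h2 : ((f p).1 k : ℝ) = p.1 k + (m k ⟨_, hb⟩ : ℝ) := by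
    rw [h1]
    ring
  exact h2

/-- The lattice vector of a face map. -/
noncomputable def homVec {c c' : toricFaceCat A b} (φ : c ⟶ c') : Fin d → ℤ :=
  (exists_latticeVec φ).choose

theorem toFun_eq_add_homVec {c c' : toricFaceCat A b} (φ : c ⟶ c')
    (p : closure (liftedFace A b (base A b c))) :
    ((φ.toFun p).1 : EuclideanSpace ℝ (Fin d)) = p.1 + latticeVec (homVec φ) :=
  (exists_latticeVec φ).choose_spec p

variable (A b) in
theorem base_mem (c : toricFaceCat A b) :
    base A b c ∈ closure (liftedFace A b (base A b c)) := by
  rw [closure_liftedFace]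
  exact self_mem_closedFace A b _

theorem homVec_eq_of_toFun {c c' : toricFaceCat A b} (φ : c ⟶ c') {v : Fin d → ℤ}
    (h : ((φ.toFun ⟨base A b c, base_mem A b c⟩).1 : EuclideanSpace ℝ (Fin d)) =
      base A b c + latticeVec v) : homVec φ = v := by
  have h1 := toFun_eq_add_homVec φ ⟨_, base_mem A b c⟩
  exact latticeVec_injective (add_left_cancel (h1.symm.trans h))

theorem homVec_id (c : toricFaceCat A b) : homVec (𝟙 c) = 0 :=
  homVec_eq_of_toFun _ (by rw [latticeVec_zero, add_zero]; rfl)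

theorem homVec_comp {c c' c'' : toricFaceCat A b} (φ : c ⟶ c') (ψ : c' ⟶ c'') :
    homVec (φ ≫ ψ) = homVec φ + homVec ψ := by
  refine homVec_eq_of_toFun _ ?_
  have h1 := toFun_eq_add_homVec φ ⟨_, base_mem A b c⟩
  have h2 := toFun_eq_add_homVec ψ (φ.toFun ⟨_, base_mem A b c⟩)
  rw [latticeVec_add, ← add_assoc]
  refine h2.trans ?_
  congr 1

theorem base_add_homVec_mem {c c' : toricFaceCat A b} (φ : c ⟶ c') :
    base A b c + latticeVec (homVec φ) ∈ closedFace A b (base A b c') := by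
  rw [← toFun_eq_add_homVec φ ⟨_, base_mem A b c⟩, ← toricComplex_P]
  exact (φ.toFun ⟨_, base_mem A b c⟩).2

theorem hom_ext_of_homVec {c c' : toricFaceCat A b} {φ ψ : c ⟶ c'} (h : homVec φ = homVec ψ) :
    φ = ψ := by
  refine CellFamily.FaceMap.ext (funext fun p => Subtype.ext ?_)
  have h1 := toFun_eq_add_homVec φ p
  rw [h] at h1
  exact h1.trans (toFun_eq_add_homVec ψ p).symm

theorem add_mem_closure_liftedFace {x y : EuclideanSpace ℝ (Fin d)} {v : Fin d → ℤ}
    (h : x + latticeVec v ∈ closedFace A b y) {p : EuclideanSpace ℝ (Fin d)}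
    (hp : p ∈ closure (liftedFace A b x)) : p + latticeVec v ∈ closure (liftedFace A b y) := by
  rw [closure_liftedFace] at hp ⊢
  exact closedFace_trans h (add_latticeVec_mem_closedFace hp v)

theorem isFace_image_add_latticeVec {x y : EuclideanSpace ℝ (Fin d)} {v : Fin d → ℤ}
    (h : x + latticeVec v ∈ closedFace A b y) {T : Set (EuclideanSpace ℝ (Fin d))}
    (hT : IsFace (closure (liftedFace A b x)) T) :
    IsFace (closure (liftedFace A b y))
      ((fun p : closure (liftedFace A b x) => p.1 + latticeVec v) '' {p | p.1 ∈ T}) := by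
  have e : (fun p : closure (liftedFace A b x) => p.1 + latticeVec v) '' {p | p.1 ∈ T} =
      (fun p => p + latticeVec v) '' T := by
    ext q
    constructor
    · rintro ⟨p, hp, rfl⟩
      exact ⟨p, hp, rfl⟩
    · rintro ⟨p, hp, rfl⟩
      exact ⟨⟨p, hT.subset hp⟩, hp, rfl⟩
  rw [e]
  rw [closure_liftedFace] at hT ⊢
  obtain ⟨z, hz, rfl⟩ := exists_eq_closedFace hT
  have e' : (fun p => p + latticeVec v) '' closedFace A b z =
      closedFace A b (z + latticeVec v) := by
    ext q
    constructor
    · rintro ⟨p, hp, rfl⟩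
      exact add_latticeVec_mem_closedFace hp v
    · intro hq
      refine ⟨q + latticeVec (-v), ?_, ?_⟩
      · have := add_latticeVec_mem_closedFace hq (-v)
        rwa [add_assoc, ← latticeVec_add, add_neg_cancel, latticeVec_zero, add_zero] at this
      · simp only [add_assoc, ← latticeVec_add, neg_add_cancel, latticeVec_zero, add_zero]
  rw [e']
  exact isFace_closedFace (closedFace_trans h (add_latticeVec_mem_closedFace hz v))

theorem torusProj_add_latticeVec (p : EuclideanSpace ℝ (Fin d)) (v : Fin d → ℤ) :
    torusProj d (p + latticeVec v) = torusProj d p := by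
  funext k
  change (((p k + (v k : ℝ)) : ℝ) : UnitAddCircle) = ((p k : ℝ) : UnitAddCircle)
  rw [AddCircle.coe_add, (AddCircle.coe_eq_zero_iff 1 (x := (v k : ℝ))).2 ⟨v k, by simp⟩, add_zero]

/-- The translation of a closed face by a lattice vector. -/
def addLatticeVec {x y : EuclideanSpace ℝ (Fin d)} {v : Fin d → ℤ}
    (h : x + latticeVec v ∈ closedFace A b y) (p : closure (liftedFace A b x)) :
    closure (liftedFace A b y) :=
  ⟨p.1 + latticeVec v, add_mem_closure_liftedFace h p.2⟩

theorem isEmbedding_addLatticeVec {x y : EuclideanSpace ℝ (Fin d)} {v : Fin d → ℤ}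
    (h : x + latticeVec v ∈ closedFace A b y) : Topology.IsEmbedding (addLatticeVec h) := by
  have h : Topology.IsEmbedding fun p : closure (liftedFace A b x) => p.1 + latticeVec v :=
    (Homeomorph.addRight (latticeVec v)).isEmbedding.comp Topology.IsEmbedding.subtypeVal
  exact Topology.IsEmbedding.of_comp (Continuous.subtype_mk h.continuous _)
    continuous_subtype_val h

/-- The face map given by a lattice vector that moves the base point into a closed face. -/
noncomputable def homOfVec {c c' : toricFaceCat A b} (v : Fin d → ℤ)
    (h : base A b c + latticeVec v ∈ closedFace A b (base A b c')) : c ⟶ c' :=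
  show (toricComplex A b).FaceMap c c' from
  { toFun := addLatticeVec h
    isEmbedding := isEmbedding_addLatticeVec h
    isFace_image := fun _ hT => isFace_image_add_latticeVec h hT
    map_toFun := fun p : closure (liftedFace A b (base A b c)) =>
      torusProj_add_latticeVec p.1 v }

theorem homVec_homOfVec {c c' : toricFaceCat A b} {v : Fin d → ℤ}
    (h : base A b c + latticeVec v ∈ closedFace A b (base A b c')) :
    homVec (homOfVec v h) = v :=
  homVec_eq_of_toFun _ rfl

/-! ### Morphisms out of a cell and faces of its zonotope -/

theorem mem_activeSet_iff {c c' : toricFaceCat A b} (φ : c ⟶ c') {j : Fin n} :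
    j ∈ activeSet A b c' ↔ j ∈ activeSet A b c ∧
      columnForm A j (base A b c' - (base A b c + latticeVec (homVec φ))) = 0 :=
  (active_iff_of_mem_closedFace (base_add_homVec_mem φ)).trans
    (and_congr_left fun _ => active_add_latticeVec A b _)

theorem supp_subset {c c' : toricFaceCat A b} (φ : c ⟶ c') : supp A b c' ⊆ supp A b c := by
  intro H hH
  obtain ⟨j, rfl⟩ := hH.1
  rw [hypersurface_mem_supp] at hH ⊢
  exact ((mem_activeSet_iff φ).1 hH).1

/-- The translation vector of the face of a zonotope given by a face map. -/
noncomputable def homShift {c c' : toricFaceCat A b} (φ : c ⟶ c') : EuclideanSpace ℝ (Fin d) :=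
  colSum A (signVec A (activeSet A b c)
    (base A b c' - (base A b c + latticeVec (homVec φ))))

theorem homShift_id (c : toricFaceCat A b) : homShift (𝟙 c) = 0 := by
  rw [homShift, homVec_id, latticeVec_zero, add_zero, sub_self]
  have : signVec A (activeSet A b c) 0 = 0 := by
    funext j
    have h0 : columnForm A j 0 = 0 := map_zero (columnLin A j)
    by_cases hj : j ∈ activeSet A b c
    · rw [signVec_of_mem A hj, h0]
      simp
    · exact signVec_of_notMem A hj _
  rw [this, map_zero]

/-- Compare coefficients column by column. A column active at `c'` contributes nothing to the shift
of `φ`, and one active only at `c` has its sign settled by `φ` and unchanged afterwards. -/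
theorem homShift_comp {c c' c'' : toricFaceCat A b} (φ : c ⟶ c') (ψ : c' ⟶ c'') :
    homShift (φ ≫ ψ) = homShift ψ + homShift φ := by
  rw [homShift, homShift, homShift, ← map_add, homVec_comp, latticeVec_add]
  congr 1
  funext j
  have hY := base_add_homVec_mem ψ
  have e : base A b c' + latticeVec (homVec ψ) -
      (base A b c + latticeVec (homVec φ) + latticeVec (homVec ψ)) =
      base A b c' - (base A b c + latticeVec (homVec φ)) := by abel
  rw [← add_assoc, Pi.add_apply]
  by_cases hj : j ∈ activeSet A b c
  · rw [signVec_of_mem A hj, signVec_of_mem A hj]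
    by_cases hj' : j ∈ activeSet A b c'
    · have h0 := ((mem_activeSet_iff φ).1 hj').2
      rw [signVec_of_mem A hj', h0]
      have e2 : base A b c'' - (base A b c + latticeVec (homVec φ) + latticeVec (homVec ψ)) =
          (base A b c'' - (base A b c' + latticeVec (homVec ψ))) +
            (base A b c' - (base A b c + latticeVec (homVec φ))) := by abel
      rw [e2, columnForm_add, h0]
      simp
    · rw [signVec_of_notMem A hj', zero_add, ← e, sign_columnForm_of_chain hY
        ((active_add_latticeVec A b _).2 ((active_add_latticeVec A b _).2 hj))
        (fun h => hj' ((active_add_latticeVec A b _).1 h))]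
  · have hj' : j ∉ activeSet A b c' := fun h => hj ((mem_activeSet_iff φ).1 h).1
    rw [signVec_of_notMem A hj, signVec_of_notMem A hj, signVec_of_notMem A hj', add_zero]

theorem image_add_homShift {c c' : toricFaceCat A b} (φ : c ⟶ c') :
    (fun p => p + homShift φ) '' zonotope A b c' = zonotopeFace A (activeSet A b c)
      (base A b c' - (base A b c + latticeVec (homVec φ))) := by
  rw [zonotope_eq]
  exact image_add_columnZonotope A fun j => mem_activeSet_iff φ

/-- If `w` selects the face, a small step from the base point along `w` enters the lifted face that
represents the target cell. -/
theorem exists_hom_of_isFace_zonotope {c : toricFaceCat A b}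
    {T : Set (EuclideanSpace ℝ (Fin d))} (hT : IsFace (zonotope A b c) T) :
    ∃ (c' : toricFaceCat A b) (φ : c ⟶ c'),
      T = (fun p => p + homShift φ) '' zonotope A b c' := by
  rw [zonotope_eq] at hT
  obtain ⟨w, rfl⟩ := exists_eq_zonotopeFace A hT
  have hc : Filter.Tendsto (fun ε : ℝ => base A b c + ε • w) (nhdsWithin 0 (Set.Ioi 0))
      (nhds (base A b c)) := by
    have : Continuous fun ε : ℝ => base A b c + ε • w := by fun_prop
    have := this.tendsto 0
    rw [zero_smul, add_zero] at this
    exact this.mono_left nhdsWithin_le_nhds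
  obtain ⟨ε, h1, hε⟩ := ((hc.eventually (eventually_mem_closedFace A b (base A b c))).and
    self_mem_nhdsWithin).exists
  let x := base A b c + ε • w
  let c' : toricFaceCat A b := Quotient.mk (faceOrbitSetoid A b) x
  obtain ⟨v, hv⟩ : ∃ v : Fin d → ℤ, SameFace A b (x + latticeVec v) (base A b c') :=
    (faceOrbitSetoid A b).symm (Quotient.mk_out (s := faceOrbitSetoid A b) x)
  have hmem : base A b c + latticeVec v ∈ closedFace A b (base A b c') :=
    closedFace_trans (SameFace.mem_closedFace (SameFace.symm A b hv))
      (add_latticeVec_mem_closedFace h1 v)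
  refine ⟨c', homOfVec v hmem, ?_⟩
  rw [image_add_homShift, homVec_homOfVec]
  refine zonotopeFace_congr A fun j hj => ?_
  rw [← SameFace.sign_eq hv ((active_add_latticeVec A b v).2 hj)]
  have e : x + latticeVec v - (base A b c + latticeVec v) = ε • w := by
    simp only [x]
    abel
  rw [e, columnForm_smul, sign_mul, sign_pos hε, one_mul]

/-- A zonotope face determines the signs of the active columns, hence the lifted face adjacent to
the base point of `c`, and so the target cell. -/
theorem sigma_eq_of_image_homShift_eq (hA : (A.map (Int.cast : ℤ → ℝ)).rank = d)
    {c c' c'' : toricFaceCat A b} (φ : c ⟶ c') (ψ : c ⟶ c'')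
    (h : (fun p => p + homShift φ) '' zonotope A b c' =
      (fun p => p + homShift ψ) '' zonotope A b c'') :
    (⟨c', φ⟩ : Σ c', (c ⟶ c')) = ⟨c'', ψ⟩ := by
  rw [image_add_homShift, image_add_homShift] at h
  have key : ∀ {e : toricFaceCat A b} (θ : c ⟶ e),
      base A b c ∈ closedFace A b (base A b e + latticeVec (-homVec θ)) := by
    intro e θ
    have := add_latticeVec_mem_closedFace (base_add_homVec_mem θ) (-homVec θ)
    rwa [add_assoc, ← latticeVec_add, add_neg_cancel, latticeVec_zero, add_zero] at this
  have hneg : ∀ v : Fin d → ℤ, latticeVec (-v) = -latticeVec v := fun v => by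
    rw [eq_neg_iff_add_eq_zero, ← latticeVec_add, neg_add_cancel, latticeVec_zero]
  have hsame : SameFace A b (base A b c' + latticeVec (-homVec φ))
      (base A b c'' + latticeVec (-homVec ψ)) := by
    refine sameFace_of_mem_closedFace (key φ) (key ψ) fun j hj => ?_
    have := sign_eq_of_zonotopeFace_eq A h hj
    rw [hneg, hneg]
    convert this using 3 <;> abel
  have hcc : c' = c'' := by
    have h1 : (faceOrbitSetoid A b) (base A b c') (base A b c'') := by
      refine ⟨-homVec φ + homVec ψ, ?_⟩
      have := hsame.add_latticeVec A b (homVec ψ)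
      rwa [add_assoc, add_assoc, ← latticeVec_add, ← latticeVec_add, neg_add_cancel,
        latticeVec_zero, add_zero] at this
    exact eq_of_base_rel h1
  subst hcc
  -- Two lattice translates of one point lie in the same lifted face. Equal floors of heights give
  -- equal integer column values, and the rank condition gives equal translations.
  have hv : homVec φ = homVec ψ := by
    apply latticeVec_injective
    rw [← sub_eq_zero]
    refine eq_zero_of_columnForm_eq_zero hA fun j => ?_
    have := ((sameFace_iff A b).1 hsame j).1
    rw [height_add_latticeVec, height_add_latticeVec, Int.floor_add_intCast,
      Int.floor_add_intCast, add_right_inj] at this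
    have h3 : columnForm A j (latticeVec (-homVec φ)) =
        columnForm A j (latticeVec (-homVec ψ)) := by
      rw [columnForm_latticeVec, columnForm_latticeVec, this]
    have h4 : latticeVec (homVec φ) - latticeVec (homVec ψ) =
        latticeVec (-homVec ψ) - latticeVec (-homVec φ) := by
      rw [hneg, hneg]
      abel
    rw [h4, columnForm_sub, h3, sub_self]
  rw [hom_ext_of_homVec hv]

variable (A b) in
/-- The zonotopes of the cells of a toric arrangement, indexed by the opposite of its face
category. -/
noncomputable def zonotopeSystem (hA : (A.map (Int.cast : ℤ → ℝ)).rank = d) :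
    FaceSystem (toricFaceCat A b)ᵒᵖ (EuclideanSpace ℝ (Fin d)) where
  poly x := zonotope A b x.unop
  shift f := homShift f.unop
  shift_id x := homShift_id x.unop
  shift_comp g f := homShift_comp f.unop g.unop
  isPolytope x := by
    rw [zonotope_eq]
    exact isPolytope_columnZonotope A _
  isFace {y x} f := by
    have := isFace_zonotopeFace A (activeSet A b x.unop)
      (base A b y.unop - (base A b x.unop + latticeVec (homVec f.unop)))
    rwa [← image_add_homShift, ← zonotope_eq] at this
  exists_hom {x T} hT := by
    obtain ⟨c', φ, h⟩ := exists_hom_of_isFace_zonotope hT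
    exact ⟨Opposite.op c', φ.op, h⟩
  hom_unique := by
    rintro ⟨y⟩ ⟨z⟩ ⟨x⟩ f g h
    obtain ⟨h1, h2⟩ := Sigma.mk.inj (sigma_eq_of_image_homShift_eq hA f.unop g.unop h)
    dsimp only at h1
    subst h1
    rw [Quiver.Hom.unop_inj (eq_of_heq h2)]

/-! ### Finiteness, and the system of products of zonotopes -/

variable (A b) in
-- Each orbit has a representative in the unit cube, where heights are bounded. Only finitely many
-- patterns of floors and ceilings occur there, and a pattern determines the face.
theorem finite_toricFaceCat : Finite (toricFaceCat A b) := by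
  let v : toricFaceCat A b → Fin d → ℤ := fun c k => -⌊base A b c k⌋
  let r : toricFaceCat A b → EuclideanSpace ℝ (Fin d) := fun c => base A b c + latticeVec (v c)
  have hr : ∀ c k, |r c k| ≤ 1 := by
    intro c k
    have : r c k = Int.fract (base A b c k) := by
      simp only [r, v, latticeVec, PiLp.add_apply, Int.cast_neg, Int.fract]
      ring
    rw [this, abs_of_nonneg (Int.fract_nonneg _)]
    exact (Int.fract_lt_one _).le
  let M : Fin n → ℝ := fun j => ∑ k, |(A k j : ℝ)| + |offset b j|
  have hM : ∀ c j, |height A b j (r c)| ≤ M j := by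
    intro c j
    refine (abs_sub _ _).trans (add_le_add_left ((Finset.abs_sum_le_sum_abs _ _).trans
      (Finset.sum_le_sum fun k _ => ?_)) _)
    rw [abs_mul]
    exact mul_le_of_le_one_right (abs_nonneg _) (hr c k)
  let g : toricFaceCat A b → ∀ j : Fin n, Set.Icc ⌊-M j⌋ ⌈M j⌉ × Set.Icc ⌊-M j⌋ ⌈M j⌉ :=
    fun c j =>
      have h1 := (abs_le.1 (hM c j)).1
      have h2 := (abs_le.1 (hM c j)).2
      (⟨⌊height A b j (r c)⌋, Int.floor_mono h1, (Int.floor_mono h2).trans (Int.floor_le_ceil _)⟩,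
        ⟨⌈height A b j (r c)⌉, (Int.floor_le_ceil _).trans (Int.ceil_mono h1), Int.ceil_mono h2⟩)
  refine Finite.of_injective g fun c c' h => ?_
  have hs : SameFace A b (r c) (r c') := by
    refine (sameFace_iff A b).2 fun j => ?_
    have := congrFun h j
    exact ⟨congrArg (fun x => x.1.1) this, congrArg (fun x => x.2.1) this⟩
  have h1 : (faceOrbitSetoid A b) (base A b c) (base A b c') :=
    (faceOrbitSetoid A b).trans ⟨v c, hs⟩
      ((faceOrbitSetoid A b).symm ⟨v c', fun _ _ _ => rfl⟩)
  exact eq_of_base_rel h1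

/-- The closed face of `c'` bounds the integer column values of the lattice vector, and these
determine the vector by the rank condition. -/
theorem finite_hom (hA : (A.map (Int.cast : ℤ → ℝ)).rank = d) (c c' : toricFaceCat A b) :
    Finite (c ⟶ c') := by
  let m : (c ⟶ c') → Fin n → ℤ := fun φ j => ∑ k, A k j * homVec φ k
  have hm : ∀ φ j, (m φ j : ℝ) = columnForm A j (latticeVec (homVec φ)) := fun φ j =>
    (columnForm_latticeVec A j _).symm
  have hb : ∀ φ j, m φ j ∈ Set.Icc ⌊(⌊height A b j (base A b c')⌋ : ℝ) - height A b j (base A b c)⌋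
      ⌈(⌈height A b j (base A b c')⌉ : ℝ) - height A b j (base A b c)⌉ := by
    intro φ j
    obtain ⟨h1, h2⟩ := base_add_homVec_mem φ j
    rw [height_add, ← hm] at h1 h2
    constructor
    · rw [← Int.cast_le (R := ℝ)]
      exact (Int.floor_le _).trans (by linarith)
    · rw [← Int.cast_le (R := ℝ)]
      exact le_trans (by linarith) (Int.le_ceil _)
  refine Finite.of_injective (fun φ j => (⟨m φ j, hb φ j⟩ : Set.Icc _ _)) fun φ ψ h => ?_
  apply hom_ext_of_homVec
  apply latticeVec_injective
  rw [← sub_eq_zero]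
  refine eq_zero_of_columnForm_eq_zero hA fun j => ?_
  have h1 : m φ j = m ψ j := congrArg Subtype.val (congrFun h j)
  rw [columnForm_sub, ← hm, ← hm, h1, sub_self]

variable (A b) in
/-- The products of zonotopes, indexed by the category `EllipticCat`. -/
noncomputable def ellipticSystem (hA : (A.map (Int.cast : ℤ → ℝ)).rank = d) :
    FaceSystem (EllipticCat A b) (EuclideanSpace ℝ (Fin d) × EuclideanSpace ℝ (Fin d)) :=
  ((zonotopeSystem A b hA).prod (zonotopeSystem A b hA)).restrict (suppDisjoint A b)
    -- A morphism into `(F, G)` is a pair of face maps out of `F` and `G`, along which supports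
    -- shrink, so disjointness is inherited by the source.
    fun {_ _} f h => Set.subset_eq_empty
      (Set.inter_subset_inter (supp_subset f.1.unop) (supp_subset f.2.unop)) h

theorem polyDim_zonotope_prod (x : EllipticCat A b) :
    polyDim (zonotope A b x.fst ×ˢ zonotope A b x.snd) = codim A b x.fst + codim A b x.snd := by
  have hne : ∀ c : toricFaceCat A b, (zonotope A b c).Nonempty := fun c => by
    rw [zonotope_eq]
    exact (isPolytope_columnZonotope A _).nonempty
  rw [polyDim_prod (hne _) (hne _), polyDim_zonotope, polyDim_zonotope]

theorem finite_ellipticCat : Finite (EllipticCat A b) := by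
  have := finite_toricFaceCat A b
  have : Finite (toricFaceCat A b)ᵒᵖ := Finite.of_equiv _ Opposite.equivToOpposite
  exact Finite.of_injective (fun x : EllipticCat A b => x.obj) fun x y h =>
    ObjectProperty.FullSubcategory.ext h

theorem finite_ellipticCat_hom (hA : (A.map (Int.cast : ℤ → ℝ)).rank = d)
    (x y : EllipticCat A b) : Finite (x ⟶ y) := by
  have h1 := finite_hom hA y.fst x.fst
  have h2 := finite_hom hA y.snd x.snd
  refine Finite.of_injective (fun f : x ⟶ y =>
    ((f.hom.1.unop, f.hom.2.unop) : (y.fst ⟶ x.fst) × (y.snd ⟶ x.snd))) fun f g h => ?_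
  apply ObjectProperty.hom_ext
  exact Prod.ext (Quiver.Hom.unop_inj (congrArg Prod.fst h))
    (Quiver.Hom.unop_inj (congrArg Prod.snd h))

end Toric

end EllipticArr

open EllipticArr in
theorem mainTheorem2 {d n : ℕ} (A : Matrix (Fin d) (Fin n) ℤ) (b : Fin n → UnitAddCircle)
    (hA : (A.map (Int.cast : ℤ → ℝ)).rank = d) :
    (∃ (X : Type) (_ : TopologicalSpace X) (K : EllipticArr.CellFamily X),
      K.IsPolyhedralCW ∧ Finite K.I ∧
      ∃ Φ : EllipticArr.EllipticCat A b ⥤ K.FaceCat,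
        Φ.IsEquivalence ∧ Function.Bijective Φ.obj ∧
        ∀ x : EllipticArr.EllipticCat A b,
          EllipticArr.polyDim (K.P (Φ.obj x)) =
            EllipticArr.codim A b x.fst + EllipticArr.codim A b x.snd) ∧
    (∀ x : EllipticArr.EllipticCat A b,
      Nonempty (Over x ≌ EllipticArr.FacePoset
        (EllipticArr.zonotope A b x.fst ×ˢ EllipticArr.zonotope A b x.snd)) ∧
      EllipticArr.polyDim
        (EllipticArr.zonotope A b x.fst ×ˢ EllipticArr.zonotope A b x.snd) =
          EllipticArr.codim A b x.fst + EllipticArr.codim A b x.snd) := by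
  have := finite_ellipticCat (A := A) (b := b)
  have := finite_ellipticCat_hom (b := b) hA
  refine ⟨?_, fun x => ⟨⟨(ellipticSystem A b hA).overEquivalence x⟩, polyDim_zonotope_prod x⟩⟩
  -- Cells must lie in a Euclidean space. Any linear isomorphism serves, since faces and dimensions
  -- are linear invariants.
  let L : (EuclideanSpace ℝ (Fin d) × EuclideanSpace ℝ (Fin d)) ≃ₗ[ℝ]
      EuclideanSpace ℝ (Fin (d + d)) :=
    LinearEquiv.ofFinrankEq _ _ (by simp)
  let S := (ellipticSystem A b hA).map L
  refine ⟨S.Space, inferInstance, S.complex, S.isPolyhedralCW_complex,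
    inferInstanceAs (Finite (EllipticCat A b)), S.toFaceCat, S.isEquivalence_toFaceCat,
    S.bijective_toFaceCat_obj, fun x => ?_⟩
  exact (polyDim_image_equiv L _).trans (polyDim_zonotope_prod x)
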